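/- **Setting.** There are $N$ base arms; arm $a\in[N]$ has a fixed reward distribution $p_a$ supported on $[0,1]$ with mean $r_a$. A family $\Theta\subseteq 2^{[N]}$ of feasible super arms is given, and $m:=\max_{A\in\Theta}|A|$. In each round $t=1,2,\dots$ a nonempty family $\Theta_t\subseteq\Theta$ of available super arms is revealed; it may be chosen by an adaptive (possibly randomized) adversary, that is, depending on everything that happened before round $t$, but not on the randomness of round $t$. The learner plays $A_t\in\Theta_t$ and observes a reward $r_{a,t}\sim p_a$ for every $a\in A_t$; the rewards of round $t$ are independent of the past and of the learner's choice in round $t$, while the rewards of different arms in the same round may be dependent. The $T$-round regret is $$\mathcal R(T)=\sum_{t=1}^T\mathbf E\Big[\max_{A\in\Theta_t}\sum_{a\in A}r_a-\sum_{a\in A_t}r_a\Big].$$ **Algorithm CL-SG** with exploration rate $\gamma>0$. Let $n_{a,t}$ be the number of rounds $\tau<t$ with $a\in A_\tau$, and let $\hat r_{a,t}$ be the average of the rewards of $a$ observed in these rounds ($\hat r_{a,t}=0$ if $n_{a,t}=0$). In round $t$ the algorithm draws one seed $w_t\sim\mathcal N(0,1)$, independent of the past and of $\Theta_t$, sets $$\bar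 r_{a,t}=\hat r_{a,t}+w_t\sqrt{\frac{\gamma\ln t}{n_{a,t}+1}}\qquad(a\in[N]),$$ and plays some $A_t\in\arg\max_{A\in\Theta_t}\sum_{a\in A}\bar r_{a,t}$, ties being broken arbitrarily. **Theorem.** Let $\gamma>0$. 1. There is a constant $C$, depending only on $\gamma$, such that for every instance as above, every availability process, and every $T\ge 2$, the regret of CL-SG satisfies $\mathcal R(T)\le C\,\ln T\,\sqrt{mNT}$. 2. There are a constant $c>0$ and an integer $T_0$, depending only on $\gamma$, such that for every $m\ge1$ and every $T\ge T_0$ there is a top-$m$ instance with $N=2m$ base arms (all $m$-element subsets of $[N]$, and no others, are feasible, and all of them are available in every round) which CL-SG can be run on, and on which it suffers regret $\mathcal R(T)\ge c\,\sqrt{mNT\ln T}$, however ties are broken. -/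

import Mathlib

open MeasureTheory ProbabilityTheory

noncomputable section

/-- A sleeping semi-bandit instance with base arms `Fin N`: a family of feasible super arms and,
for every base arm, a reward distribution supported on `[0, 1]`. -/
structure SemiBandit (N : ℕ) where
  feasible : Finset (Finset (Fin N))
  law : Fin N → Measure ℝ
  isProb : ∀ a, IsProbabilityMeasure (law a)
  support : ∀ a, ∀ᵐ x ∂(law a), x ∈ Set.Icc (0 : ℝ) 1

namespace SemiBandit

variable {N : ℕ} (I : SemiBandit N)

/-- The mean reward `r_a` of a base arm. -/
def mean (a : Fin N) : ℝ := ∫ x, x ∂(I.law a)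

/-- The maximum cardinality `m` of a feasible super arm. -/
def maxCard : ℕ := I.feasible.sup Finset.card

/-- The mean reward of a super arm. -/
def value (B : Finset (Fin N)) : ℝ := ∑ a ∈ B, I.mean a

/-- The mean reward of an optimal super arm in a nonempty family `S` of super arms. -/
def optValue (S : Finset (Finset (Fin N))) : ℝ :=
  if h : S.Nonempty then S.sup' h I.value else 0

/-- The top-`m` constraint: the feasible super arms are exactly the `m`-element sets. -/
def IsTop (m : ℕ) : Prop := I.feasible = Finset.univ.powersetCard m

end SemiBandit

/-! Rounds are `t = 1, 2, …`. The lists of played super arms and of rewards along one outcome are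
`A : ℕ → Finset (Fin N)` and `X : ℕ → Fin N → ℝ`; their entries at `0` are never used. -/

/-- `n_{a,t}`: number of plays of `a` in the rounds `1, …, t - 1`. -/
def pulls {N : ℕ} (A : ℕ → Finset (Fin N)) (a : Fin N) (t : ℕ) : ℕ :=
  ((Finset.Ico 1 t).filter (fun τ => a ∈ A τ)).card

/-- Empirical mean of `a` at the beginning of round `t`; it is `0` if `a` was never played. -/
def empMean {N : ℕ} (A : ℕ → Finset (Fin N)) (X : ℕ → Fin N → ℝ) (a : Fin N) (t : ℕ) : ℝ :=
  (∑ τ ∈ (Finset.Ico 1 t).filter (fun τ => a ∈ A τ), X τ a) / (pulls A a t : ℝ)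

/-- The perturbed estimate of `a` in round `t` when the shared seed takes the value `w`. -/
def perturbed {N : ℕ} (γ : ℝ) (A : ℕ → Finset (Fin N)) (X : ℕ → Fin N → ℝ) (w : ℝ)
    (a : Fin N) (t : ℕ) : ℝ :=
  empMean A X a t + w * Real.sqrt (γ * Real.log t / ((pulls A a t : ℝ) + 1))

/-- `IsCLSGRun I γ μ 𝓕 Θ w A X`: on the probability space `(Ω, μ)`, CL-SG with exploration rate `γ`
is run on the instance `I`. `𝓕 t` is the information available at the end of round `t`; it may
contain additional randomness (for the availability of arms and for breaking ties). In round `t`,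
`Θ t` is the family of available super arms, `w t` the seed, `A t` the super arm that is
played, and `X t a` the reward of the base arm `a`.

* The availability is chosen by an adaptive adversary: it may depend on everything that happened
  before, but not on the seed and the rewards of the current round.
* Rewards are independent of the past and of the decision in the current round; the rewards of
  different base arms in one round may depend on each other. -/
structure IsCLSGRun {N : ℕ} (I : SemiBandit N) (γ : ℝ) {Ω : Type*} [mΩ : MeasurableSpace Ω]
    (μ : Measure Ω) (𝓕 : Filtration ℕ mΩ) (Θ : ℕ → Ω → Finset (Finset (Fin N)))
    (w : ℕ → Ω → ℝ) (A : ℕ → Ω → Finset (Fin N)) (X : ℕ → Fin N → Ω → ℝ) : Prop where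
  avail_meas : ∀ t S, MeasurableSet[𝓕 t] {ω | Θ (t + 1) ω = S}
  avail_subset : ∀ t ω, Θ (t + 1) ω ⊆ I.feasible
  avail_nonempty : ∀ t ω, (Θ (t + 1) ω).Nonempty
  seed_meas : ∀ t, Measurable[𝓕 (t + 1)] (w (t + 1))
  seed_law : ∀ t, μ.map (w (t + 1)) = gaussianReal 0 1
  seed_indep : ∀ t, Indep (MeasurableSpace.comap (w (t + 1)) inferInstance) (𝓕 t) μ
  play_meas : ∀ t B, MeasurableSet[𝓕 (t + 1)] {ω | A (t + 1) ω = B}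
  play_mem : ∀ t ω, A (t + 1) ω ∈ Θ (t + 1) ω
  play_max : ∀ t ω, ∀ B ∈ Θ (t + 1) ω,
    ∑ a ∈ B, perturbed γ (fun τ => A τ ω) (fun τ b => X τ b ω) (w (t + 1) ω) a (t + 1) ≤
      ∑ a ∈ A (t + 1) ω,
        perturbed γ (fun τ => A τ ω) (fun τ b => X τ b ω) (w (t + 1) ω) a (t + 1)
  reward_meas : ∀ t a, Measurable[𝓕 (t + 1)] (X (t + 1) a)
  reward_law : ∀ t a, μ.map (X (t + 1) a) = I.law a
  reward_indep : ∀ t,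
    Indep (MeasurableSpace.comap (fun ω a => X (t + 1) a ω) inferInstance)
      (𝓕 t ⊔ MeasurableSpace.comap (w (t + 1)) inferInstance ⊔
        MeasurableSpace.comap (A (t + 1)) ⊤) μ

/-- The `T`-round pseudo-regret. -/
def regret {N : ℕ} (I : SemiBandit N) {Ω : Type*} [MeasurableSpace Ω] (μ : Measure Ω)
    (Θ : ℕ → Ω → Finset (Finset (Fin N))) (A : ℕ → Ω → Finset (Fin N)) (T : ℕ) : ℝ :=
  ∑ t ∈ Finset.Icc 1 T, ∫ ω, (I.optValue (Θ t ω) - I.value (A t ω)) ∂μ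

end

/-!
Upper bound: at the seed `K = √(3 / γ)` the perturbations dominate the estimation errors of all arms
of round `t` with probability `1 - 2N / t²`, so the regret of the round is controlled by the
perturbed maximum at `K`. As a function of the seed shared by all arms this maximum is an upper
envelope of lines, hence convex: its growth between `K` and `K + 1` is at most its slope at any seed
beyond `K + 1`, which is the total bonus of the arms that are played there. Such a seed is drawn
with constant probability independently of the past, so the bonuses of the played arms pay for the
regret, and their squares have a harmonic sum.

Lower bound: half of the arms have reward `Δ = √(γ log T / T) / 8`, the others `0`. As long as the
bad arms are rarely played, their bonuses are larger than those of the good arms by a constant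
factor, and a seed larger than `1` makes an arm that is rarely played look better than a good one.
-/

/-! ### Randomly indexed functions -/

theorem measurable_apply_index {Ω ι β : Type*} {m : MeasurableSpace Ω} [MeasurableSpace β]
    [Countable ι] {θ : Ω → ι} (hθ : ∀ i, MeasurableSet {ω | θ ω = i}) {g : ι → Ω → β}
    (hg : ∀ i, Measurable (g i)) : Measurable fun ω => g (θ ω) ω := by
  intro s hs
  have hpre : (fun ω => g (θ ω) ω) ⁻¹' s = ⋃ i, {ω | θ ω = i} ∩ g i ⁻¹' s := by
    ext ω; simp
  exact hpre ▸ MeasurableSet.iUnion fun i => (hθ i).inter (hg i hs)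

theorem measurableSet_apply_index {Ω ι : Type*} {_ : MeasurableSpace Ω} [Countable ι] {θ : Ω → ι}
    (hθ : ∀ i, MeasurableSet {ω | θ ω = i}) {p : ι → Ω → Prop}
    (hp : ∀ i, MeasurableSet {ω | p i ω}) : MeasurableSet {ω | p (θ ω) ω} :=
  measurableSet_setOfPred.2
    (measurable_apply_index hθ fun i => measurableSet_setOfPred.1 (hp i))

theorem measurableSet_of_index {Ω ι : Type*} {_ : MeasurableSpace Ω} [Countable ι] {θ : Ω → ι}
    (hθ : ∀ i, MeasurableSet {ω | θ ω = i}) (p : ι → Prop) : MeasurableSet {ω | p (θ ω)} :=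
  measurableSet_apply_index hθ fun i => MeasurableSet.const (p i)

/-! ### Moments of a centred Gaussian -/

section Gaussian

open scoped NNReal

theorem integral_sq_gaussianReal_zero (v : ℝ≥0) : ∫ x, x ^ 2 ∂gaussianReal 0 v = v := by
  have h := variance_eq_sub (memLp_id_gaussianReal (μ := 0) (v := v) 2)
  simpa [variance_id_gaussianReal, integral_id_gaussianReal] using h.symm

theorem integral_abs_gaussianReal_zero_le (v : ℝ≥0) :
    ∫ x, |x| ∂gaussianReal 0 v ≤ Real.sqrt v := by
  have hvar := variance_eq_sub (memLp_id_gaussianReal (μ := 0) (v := v) 2).abs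
  have hnonneg := variance_nonneg |id| (gaussianReal 0 v)
  simp only [hvar, Pi.pow_apply, Pi.abs_apply, id_eq, sq_abs,
    integral_sq_gaussianReal_zero, sub_nonneg] at hnonneg
  exact Real.le_sqrt_of_sq_le hnonneg

theorem integrable_abs_gaussianReal (m : ℝ) (v : ℝ≥0) :
    Integrable (fun x : ℝ => |x|) (gaussianReal m v) :=
  (memLp_id_gaussianReal (μ := m) (v := v) 1).abs.integrable (by simp)

theorem integrable_max_sub_gaussianReal (m : ℝ) (v : ℝ≥0) (c : ℝ) :
    Integrable (fun x : ℝ => max (c - x) 0) (gaussianReal m v) :=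
  ((integrable_const c).sub ((memLp_id_gaussianReal (μ := m) (v := v) 1).integrable
    (by simp))).pos_part

theorem integral_max_sub_gaussianReal_zero_le {c : ℝ} (hc : 0 ≤ c) (v : ℝ≥0) :
    ∫ x, max (c - x) 0 ∂gaussianReal 0 v ≤ c + Real.sqrt v := by
  calc ∫ x, max (c - x) 0 ∂gaussianReal 0 v
      ≤ ∫ x, (c + |x|) ∂gaussianReal 0 v :=
        integral_mono (integrable_max_sub_gaussianReal 0 v c)
          ((integrable_const c).add (integrable_abs_gaussianReal 0 v)) fun x =>
          max_le (by linarith [neg_abs_le x]) (add_nonneg hc (abs_nonneg x))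
    _ = c + ∫ x, |x| ∂gaussianReal 0 v := by
        rw [integral_add (integrable_const c) (integrable_abs_gaussianReal 0 v)]
        simp
    _ ≤ c + Real.sqrt v := by grw [integral_abs_gaussianReal_zero_le]

theorem gaussianReal_real_Ioi_pos (m : ℝ) {v : ℝ≥0} (hv : v ≠ 0) (x : ℝ) :
    0 < (gaussianReal m v).real (Set.Ioi x) := by
  refine ENNReal.toReal_pos (fun h0 => ?_) (measure_ne_top _ _)
  simpa using gaussianReal_absolutelyContinuous' m hv h0

end Gaussian

/-! ### Concentration of adaptively sampled sums -/

section Sampling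

open scoped NNReal ENNReal

variable {Ω : Type*}

/-- The sum of those among the first `t` observations `Y 0, …, Y (t - 1)` that are sampled, the
`s`-th one being sampled on the event `P s`. With `Y = 1` this is the number of samples. -/
noncomputable def sampledSum (P : ℕ → Set Ω) (Y : ℕ → Ω → ℝ) (t : ℕ) (ω : Ω) : ℝ :=
  ∑ s ∈ Finset.range t, (P s).indicator (Y s) ω

theorem sampledSum_succ (P : ℕ → Set Ω) (Y : ℕ → Ω → ℝ) (t : ℕ) (ω : Ω) :
    sampledSum P Y (t + 1) ω = sampledSum P Y t ω + (P t).indicator (Y t) ω :=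
  Finset.sum_range_succ _ _

theorem lintegral_exp_le_one_of_hasSubgaussianMGF {mΩ : MeasurableSpace Ω} {μ : Measure Ω}
    {c : ℝ≥0} {Z : Ω → ℝ} (hZ : HasSubgaussianMGF Z c μ) (l : ℝ) :
    ∫⁻ ω, ENNReal.ofReal (Real.exp (l * Z ω - c * l ^ 2 / 2)) ∂μ ≤ 1 := by
  simp only [Real.exp_sub]
  rw [← ofReal_integral_eq_lintegral_ofReal ((hZ.integrable_exp_mul l).div_const _)
    (ae_of_all _ fun ω => by positivity), integral_div]
  exact ENNReal.ofReal_le_one.2 (div_le_one_of_le₀ (hZ.mgf_le l) (Real.exp_nonneg _))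

theorem lintegral_mul_exp_indicator_le {m mΩ : MeasurableSpace Ω} (hm : m ≤ mΩ)
    {μ : Measure Ω} {c : ℝ≥0} {Q : Set Ω}
    (hQ : MeasurableSet[m] Q) {f : Ω → ℝ≥0∞} (hf : Measurable[m] f) {Z : Ω → ℝ}
    (hZm : Measurable Z) (hZ : HasSubgaussianMGF Z c μ)
    (hind : Indep (MeasurableSpace.comap Z inferInstance) m μ) (l : ℝ) :
    ∫⁻ ω, f ω * ENNReal.ofReal (Real.exp (Q.indicator (fun ω => l * Z ω - c * l ^ 2 / 2) ω)) ∂μ ≤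
      ∫⁻ ω, f ω ∂μ := by
  set e : Ω → ℝ≥0∞ := fun ω => ENNReal.ofReal (Real.exp (l * Z ω - c * l ^ 2 / 2)) with he
  have hQ' : MeasurableSet Q := hm _ hQ
  have he_meas : Measurable[MeasurableSpace.comap Z inferInstance] e :=
    (((comap_measurable Z).const_mul l).sub_const _).exp.ennreal_ofReal
  have hsplit : ∀ ω, f ω * ENNReal.ofReal (Real.exp
      (Q.indicator (fun ω => l * Z ω - c * l ^ 2 / 2) ω)) =
      Q.indicator f ω * e ω + Qᶜ.indicator f ω := fun ω => by
    by_cases hω : ω ∈ Q <;> simp [hω, he]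
  calc _ = ∫⁻ ω, Q.indicator f ω * e ω ∂μ + ∫⁻ ω, Qᶜ.indicator f ω ∂μ := by
        rw [lintegral_congr hsplit,
          lintegral_add_right _ ((hf.mono hm le_rfl).indicator hQ'.compl)]
    _ = (∫⁻ ω, Q.indicator f ω ∂μ) * ∫⁻ ω, e ω ∂μ + ∫⁻ ω, Qᶜ.indicator f ω ∂μ := by
        rw [lintegral_mul_eq_lintegral_mul_lintegral_of_independent_measurableSpace hm
          hZm.comap_le hind.symm (hf.indicator hQ) he_meas]
    _ ≤ (∫⁻ ω, Q.indicator f ω ∂μ) * 1 + ∫⁻ ω, Qᶜ.indicator f ω ∂μ := by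
        gcongr; exact lintegral_exp_le_one_of_hasSubgaussianMGF hZ l
    _ = ∫⁻ ω, f ω ∂μ := by
        rw [mul_one, lintegral_indicator hQ', lintegral_indicator hQ'.compl,
          lintegral_add_compl _ hQ']

theorem measure_ge_le_ofReal_exp_neg {mΩ : MeasurableSpace Ω} {μ : Measure Ω} {Z : Ω → ℝ}
    (hZm : Measurable Z) (hZ : ∫⁻ ω, ENNReal.ofReal (Real.exp (Z ω)) ∂μ ≤ 1) (y : ℝ) :
    μ {ω | y ≤ Z ω} ≤ ENNReal.ofReal (Real.exp (-y)) := by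
  have hmarkov := (mul_meas_ge_le_lintegral hZm.exp.ennreal_ofReal
    (ENNReal.ofReal (Real.exp y))).trans hZ
  simp only [ENNReal.ofReal_le_ofReal_iff (Real.exp_nonneg _), Real.exp_le_exp] at hmarkov
  rwa [Real.exp_neg, ENNReal.ofReal_inv_of_pos (Real.exp_pos _), ← one_div,
    ENNReal.le_div_iff_mul_le (Or.inl (by simp [Real.exp_pos])) (Or.inl ENNReal.ofReal_ne_top),
    mul_comm]

variable [mΩ : MeasurableSpace Ω] {μ : Measure Ω} {𝓖 : Filtration ℕ mΩ} {P : ℕ → Set Ω}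
  {Y : ℕ → Ω → ℝ} {c : ℝ≥0}

theorem measurable_sampledSum (h : ∀ s, Measurable[𝓖 (s + 1)] ((P s).indicator (Y s))) (t : ℕ) :
    Measurable[𝓖 t] (sampledSum P Y t) :=
  Finset.measurable_fun_sum _ fun s hs =>
    (h s).mono (𝓖.mono (Finset.mem_range.1 hs)) le_rfl

variable (hP : ∀ s, MeasurableSet[𝓖 s] (P s)) (hY : ∀ s, Measurable[𝓖 (s + 1)] (Y s))

include hP hY in
theorem measurable_exponent (l : ℝ) (t : ℕ) : Measurable[𝓖 t] fun ω =>
    l * sampledSum P Y t ω - c * l ^ 2 / 2 * sampledSum P 1 t ω :=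
  ((measurable_sampledSum
    (fun s => (hY s).indicator (𝓖.mono s.le_succ _ (hP s))) t).const_mul l).sub
  ((measurable_sampledSum
    (fun s => measurable_const.indicator (𝓖.mono s.le_succ _ (hP s))) t).const_mul _)

variable (hsub : ∀ s, HasSubgaussianMGF (Y s) c μ)
  (hind : ∀ s, Indep (MeasurableSpace.comap (Y s) inferInstance) (𝓖 s) μ)

include hP hY hsub hind

theorem lintegral_exp_sampledSum_le_one [IsProbabilityMeasure μ] (l : ℝ) (t : ℕ) :
    ∫⁻ ω, ENNReal.ofReal (Real.exp
      (l * sampledSum P Y t ω - c * l ^ 2 / 2 * sampledSum P 1 t ω)) ∂μ ≤ 1 := by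
  induction t with
  | zero => simp [sampledSum]
  | succ t ih =>
    refine le_trans (le_of_eq (lintegral_congr fun ω => ?_))
      ((lintegral_mul_exp_indicator_le (𝓖.le t) (hP t)
        (measurable_exponent hP hY l t).exp.ennreal_ofReal
        ((hY t).mono (𝓖.le _) le_rfl) (hsub t) (hind t) l).trans ih)
    rw [← ENNReal.ofReal_mul (Real.exp_nonneg _), ← Real.exp_add, sampledSum_succ, sampledSum_succ]
    by_cases hω : ω ∈ P t
    · simp only [Set.indicator_of_mem hω, Pi.one_apply]; ring_nf
    · simp only [Set.indicator_of_notMem hω, add_zero]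

theorem measure_sampledSum_ge_le [IsProbabilityMeasure μ] (l y : ℝ) (t : ℕ) :
    μ {ω | y ≤ l * sampledSum P Y t ω - c * l ^ 2 / 2 * sampledSum P 1 t ω} ≤
      ENNReal.ofReal (Real.exp (-y)) :=
  measure_ge_le_ofReal_exp_neg ((measurable_exponent hP hY l t).mono (𝓖.le t) le_rfl)
    (lintegral_exp_sampledSum_le_one hP hY hsub hind l t) y

theorem measure_abs_sampledSum_ge_le [IsProbabilityMeasure μ] (hc : c ≠ 0) {n : ℕ} (hn : n ≠ 0)
    {x : ℝ} (hx : 0 ≤ x) (t : ℕ) :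
    μ {ω | sampledSum P 1 t ω = n ∧ x ≤ |sampledSum P Y t ω|} ≤
      2 * ENNReal.ofReal (Real.exp (-(x ^ 2 / (2 * c * n)))) := by
  have hc' : (c : ℝ) ≠ 0 := by exact_mod_cast hc
  have hn' : (n : ℝ) ≠ 0 := by exact_mod_cast hn
  -- The exponent `l * x - c * l ^ 2 / 2 * n` is largest at this value of `l`.
  set l : ℝ := x / (c * n) with hl
  have hl0 : 0 ≤ l := by positivity
  have hexponent : l * x - c * l ^ 2 / 2 * n = x ^ 2 / (2 * c * n) := by
    rw [hl]; field_simp; ring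
  rw [two_mul]
  refine (measure_mono ?_).trans ((measure_union_le _ _).trans (add_le_add
    (measure_sampledSum_ge_le hP hY hsub hind l (x ^ 2 / (2 * c * n)) t)
    (measure_sampledSum_ge_le hP hY hsub hind (-l) (x ^ 2 / (2 * c * n)) t)))
  rintro ω ⟨hcount, habs⟩
  rcases le_abs.1 habs with hω | hω
  · left
    simp only [Set.mem_ofPred_eq, hcount]
    linarith [mul_le_mul_of_nonneg_left hω hl0]
  · right
    simp only [Set.mem_ofPred_eq, hcount, neg_sq]
    linarith [mul_le_mul_of_nonneg_left hω hl0]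

end Sampling

/-! ### The upper envelope of a family of lines -/

section UpperEnvelope

variable {ι : Type*} {S : Finset ι} {u v : ι → ℝ}

/-- The upper envelope at `x` of the lines `x ↦ u i + x * v i` with `i ∈ S`; it is `0` if `S` is
empty. For the super arms `i`, their estimates `u i` and bonuses `v i` this is the perturbed maximum
as a function of the shared seed `x`. -/
noncomputable def upperEnvelope (S : Finset ι) (u v : ι → ℝ) (x : ℝ) : ℝ :=
  if h : S.Nonempty then S.sup' h fun i => u i + x * v i else 0

theorem le_upperEnvelope (u v : ι → ℝ) (x : ℝ) {i : ι} (hi : i ∈ S) :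
    u i + x * v i ≤ upperEnvelope S u v x := by
  rw [upperEnvelope, dif_pos ⟨i, hi⟩]
  exact Finset.le_sup' (fun i => u i + x * v i) hi

theorem exists_upperEnvelope_eq (hS : S.Nonempty) (u v : ι → ℝ) (x : ℝ) :
    ∃ i ∈ S, upperEnvelope S u v x = u i + x * v i := by
  rw [upperEnvelope, dif_pos hS]
  exact Finset.exists_mem_eq_sup' hS _

theorem upperEnvelope_eq_of_maximal {x : ℝ} {i : ι} (hi : i ∈ S)
    (hmax : ∀ j ∈ S, u j + x * v j ≤ u i + x * v i) : upperEnvelope S u v x = u i + x * v i := by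
  obtain ⟨j, hj, hjx⟩ := exists_upperEnvelope_eq ⟨i, hi⟩ u v x
  exact le_antisymm (hjx.trans_le (hmax j hj)) (le_upperEnvelope u v x hi)

theorem monotone_upperEnvelope (hv : ∀ i ∈ S, 0 ≤ v i) : Monotone (upperEnvelope S u v) := by
  intro x y hxy
  rcases S.eq_empty_or_nonempty with rfl | hS
  · simp [upperEnvelope]
  obtain ⟨i, hi, hix⟩ := exists_upperEnvelope_eq hS u v x
  rw [hix]
  exact (by gcongr; exact hv i hi : u i + x * v i ≤ u i + y * v i).trans
    (le_upperEnvelope u v y hi)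

theorem upperEnvelope_sub_le_mul {c x y : ℝ} (hS : S.Nonempty) (hv : ∀ i ∈ S, v i ≤ c)
    (hxy : x ≤ y) : upperEnvelope S u v y - upperEnvelope S u v x ≤ (y - x) * c := by
  obtain ⟨i, hi, hiy⟩ := exists_upperEnvelope_eq hS u v y
  calc upperEnvelope S u v y - upperEnvelope S u v x
      ≤ (y - x) * v i := by linarith [le_upperEnvelope u v x hi]
    _ ≤ (y - x) * c := mul_le_mul_of_nonneg_left (hv i hi) (sub_nonneg.2 hxy)

theorem upperEnvelope_sub_le_mul_of_maximal {x y w : ℝ} (hxy : x ≤ y) (hyw : y < w) {i : ι}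
    (hi : i ∈ S) (hmax : ∀ j ∈ S, u j + w * v j ≤ u i + w * v i) :
    upperEnvelope S u v y - upperEnvelope S u v x ≤ (y - x) * v i := by
  obtain ⟨j, hj, hjy⟩ := exists_upperEnvelope_eq ⟨i, hi⟩ u v y
  have hslope : v j ≤ v i := by
    refine le_of_mul_le_mul_left ?_ (sub_pos.2 hyw)
    linarith [hmax j hj, le_upperEnvelope u v y hi]
  calc upperEnvelope S u v y - upperEnvelope S u v x
      ≤ (y - x) * v j := by linarith [le_upperEnvelope u v x hj]
    _ ≤ (y - x) * v i := mul_le_mul_of_nonneg_left hslope (sub_nonneg.2 hxy)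

theorem upperEnvelope_sub_le_max_mul (hS : S.Nonempty) (hv : ∀ i ∈ S, 0 ≤ v i) (x w : ℝ) :
    upperEnvelope S u v x - upperEnvelope S u v w ≤
      max (x - w) 0 * (upperEnvelope S u v (x + 1) - upperEnvelope S u v x) := by
  obtain ⟨i, hi, hix⟩ := exists_upperEnvelope_eq hS u v x
  calc upperEnvelope S u v x - upperEnvelope S u v w
      ≤ (x - w) * v i := by linarith [le_upperEnvelope u v w hi]
    _ ≤ max (x - w) 0 * v i := mul_le_mul_of_nonneg_right (le_max_left _ _) (hv i hi)
    _ ≤ _ := by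
        refine mul_le_mul_of_nonneg_left ?_ (le_max_right _ _)
        linarith [le_upperEnvelope u v (x + 1) hi]

theorem sub_le_of_abs_sub_le_of_maximal {r : ι → ℝ} {K ξ w : ℝ} (hv : ∀ i ∈ S, 0 ≤ v i)
    (hdev : ∀ i ∈ S, |u i - r i| ≤ K * v i + ξ) {i j : ι} (hi : i ∈ S) (hj : j ∈ S)
    (hmax : ∀ k ∈ S, u k + w * v k ≤ u i + w * v i) :
    r j - r i ≤ (|w| + K) * v i +
      max (K - w) 0 * (upperEnvelope S u v (K + 1) - upperEnvelope S u v K) + 2 * ξ := by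
  have hopt : r j ≤ upperEnvelope S u v K + ξ := by
    linarith [(abs_le.1 (hdev j hj)).1, le_upperEnvelope u v K hj]
  have hplayed : u i - K * v i - ξ ≤ r i := by linarith [(abs_le.1 (hdev i hi)).2]
  have hseed : w * v i ≤ |w| * v i := mul_le_mul_of_nonneg_right (le_abs_self w) (hv i hi)
  have hgrowth := upperEnvelope_sub_le_max_mul ⟨i, hi⟩ hv (u := u) K w
  rw [upperEnvelope_eq_of_maximal hi hmax] at hgrowth
  linarith

theorem measurable_upperEnvelope {Ω : Type*} {m : MeasurableSpace Ω} [Countable ι]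
    {θ : Ω → Finset ι} (hθ : ∀ S, MeasurableSet {ω | θ ω = S}) {u v : ι → Ω → ℝ}
    (hu : ∀ i, Measurable (u i)) (hv : ∀ i, Measurable (v i)) (x : ℝ) :
    Measurable fun ω => upperEnvelope (θ ω) (fun i => u i ω) (fun i => v i ω) x := by
  refine measurable_apply_index
    (g := fun S ω => upperEnvelope S (fun i => u i ω) (fun i => v i ω) x) hθ fun S => ?_
  by_cases hS : S.Nonempty
  · simp only [upperEnvelope, dif_pos hS]
    convert! Finset.measurable_sup' hS (f := fun i ω => u i ω + x * v i ω)
      fun i _ => (hu i).add ((hv i).const_mul x) using 1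
    ext ω
    rw [Finset.sup'_apply]
  · simp only [upperEnvelope, dif_neg hS]
    exact measurable_const

end UpperEnvelope

/-! ### Counts, empirical means and bonuses -/

section Counts

variable {N : ℕ}

theorem pulls_one (A : ℕ → Finset (Fin N)) (a : Fin N) : pulls A a 1 = 0 := by simp [pulls]

theorem pulls_add_two (A : ℕ → Finset (Fin N)) (a : Fin N) (t : ℕ) :
    pulls A a (t + 2) = pulls A a (t + 1) + if a ∈ A (t + 1) then 1 else 0 := by
  simp only [pulls, Finset.card_filter]
  rw [Finset.sum_Ico_succ_top (by omega)]

theorem pulls_succ_le (A : ℕ → Finset (Fin N)) (a : Fin N) (t : ℕ) : pulls A a (t + 1) ≤ t :=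
  (Finset.card_filter_le _ _).trans (by simp)

theorem sum_pulls_succ (A : ℕ → Finset (Fin N)) (S : Finset (Fin N)) (t : ℕ) :
    ∑ a ∈ S, pulls A a (t + 1) = ∑ s ∈ Finset.range t, (A (s + 1) ∩ S).card := by
  induction t with
  | zero => simp [pulls_one]
  | succ t ih =>
    simp only [pulls_add_two, Finset.sum_add_distrib]
    rw [ih, Finset.sum_range_succ, ← Finset.card_filter, Finset.filter_mem_eq_inter,
      Finset.inter_comm]

theorem empMean_mem_Icc {A : ℕ → Finset (Fin N)} {X : ℕ → Fin N → ℝ} {a : Fin N}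
    (hX : ∀ t, X (t + 1) a ∈ Set.Icc (0 : ℝ) 1) (t : ℕ) :
    empMean A X a t ∈ Set.Icc (0 : ℝ) 1 := by
  have hmem : ∀ τ ∈ (Finset.Ico 1 t).filter (fun τ => a ∈ A τ), X τ a ∈ Set.Icc (0 : ℝ) 1 :=
    fun τ hτ => Nat.sub_add_cancel (Finset.mem_Ico.1 (Finset.mem_filter.1 hτ).1).1 ▸ hX (τ - 1)
  refine ⟨div_nonneg (Finset.sum_nonneg fun τ hτ => (hmem τ hτ).1) (Nat.cast_nonneg _),
    div_le_one_of_le₀ ?_ (Nat.cast_nonneg _)⟩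
  simpa [pulls] using Finset.sum_le_card_nsmul _ _ 1 fun τ hτ => (hmem τ hτ).2

theorem empMean_eq_of_forall_eq {A : ℕ → Finset (Fin N)} {X : ℕ → Fin N → ℝ} {a : Fin N} {r : ℝ}
    (hX : ∀ t, X (t + 1) a = r) {t : ℕ} (hn : pulls A a t ≠ 0) : empMean A X a t = r := by
  have heq : ∀ τ ∈ (Finset.Ico 1 t).filter (fun τ => a ∈ A τ), X τ a = r :=
    fun τ hτ => Nat.sub_add_cancel (Finset.mem_Ico.1 (Finset.mem_filter.1 hτ).1).1 ▸ hX (τ - 1)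
  rw [empMean, Finset.sum_congr rfl heq, Finset.sum_const, nsmul_eq_mul]
  exact mul_div_cancel_left₀ r (by exact_mod_cast hn)

theorem sum_inv_pulls_of_mem (A : ℕ → Finset (Fin N)) (a : Fin N) (T : ℕ) :
    ∑ t ∈ Finset.range T, (if a ∈ A (t + 1) then ((pulls A a (t + 1) : ℝ) + 1)⁻¹ else 0) =
      ∑ k ∈ Finset.range (pulls A a (T + 1)), ((k : ℝ) + 1)⁻¹ := by
  induction T with
  | zero => simp [pulls_one]
  | succ T ih =>
    rw [Finset.sum_range_succ, ih, pulls_add_two]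
    split_ifs <;> simp [Finset.sum_range_succ]

theorem sum_inv_pulls_le (A : ℕ → Finset (Fin N)) (T : ℕ) :
    ∑ t ∈ Finset.range T, ∑ a ∈ A (t + 1), ((pulls A a (t + 1) : ℝ) + 1)⁻¹ ≤
      N * (1 + Real.log T) := by
  have harm : ∀ a : Fin N, ∑ t ∈ Finset.range T,
      (if a ∈ A (t + 1) then ((pulls A a (t + 1) : ℝ) + 1)⁻¹ else 0) ≤ 1 + Real.log T := fun a =>
    calc _ = ∑ k ∈ Finset.range (pulls A a (T + 1)), ((k : ℝ) + 1)⁻¹ := sum_inv_pulls_of_mem A a T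
      _ ≤ ∑ k ∈ Finset.range T, ((k : ℝ) + 1)⁻¹ :=
          Finset.sum_le_sum_of_subset_of_nonneg (Finset.range_mono (pulls_succ_le A a T))
            fun k _ _ => by positivity
      _ ≤ 1 + Real.log T := by simpa [harmonic] using harmonic_le_one_add_log T
  calc _ = ∑ a : Fin N, ∑ t ∈ Finset.range T,
        (if a ∈ A (t + 1) then ((pulls A a (t + 1) : ℝ) + 1)⁻¹ else 0) := by
        rw [Finset.sum_comm]
        simp
    _ ≤ ∑ _a : Fin N, (1 + Real.log T) := Finset.sum_le_sum fun a _ => harm a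
    _ = N * (1 + Real.log T) := by rw [Finset.sum_const, Finset.card_fin, nsmul_eq_mul]

/-- The exploration bonus of the base arm `a` in round `t` per unit of the seed. -/
noncomputable def bonus (γ : ℝ) (A : ℕ → Finset (Fin N)) (a : Fin N) (t : ℕ) : ℝ :=
  Real.sqrt (γ * Real.log t / ((pulls A a t : ℝ) + 1))

theorem bonus_nonneg (γ : ℝ) (A : ℕ → Finset (Fin N)) (a : Fin N) (t : ℕ) :
    0 ≤ bonus γ A a t := Real.sqrt_nonneg _

variable {γ : ℝ} (hγ : 0 ≤ γ)

include hγ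

theorem bonus_le (A : ℕ → Finset (Fin N)) (a : Fin N) (t : ℕ) :
    bonus γ A a t ≤ Real.sqrt (γ * Real.log t) :=
  Real.sqrt_le_sqrt (div_le_self (mul_nonneg hγ (Real.log_natCast_nonneg t)) (by simp))

theorem sum_bonus_le (A : ℕ → Finset (Fin N)) (B : Finset (Fin N)) (t : ℕ) :
    ∑ a ∈ B, bonus γ A a t ≤ N * Real.sqrt (γ * Real.log t) :=
  calc ∑ a ∈ B, bonus γ A a t ≤ ∑ _a : Fin N, Real.sqrt (γ * Real.log t) :=
        (Finset.sum_le_sum fun a _ => bonus_le hγ A a t).trans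
          (Finset.sum_le_sum_of_subset_of_nonneg B.subset_univ fun _ _ _ => Real.sqrt_nonneg _)
    _ = N * Real.sqrt (γ * Real.log t) := by simp

theorem sq_sum_bonus_le (A : ℕ → Finset (Fin N)) (B : Finset (Fin N)) (t : ℕ) :
    (∑ a ∈ B, bonus γ A a t) ^ 2 ≤
      B.card * (γ * Real.log t) * ∑ a ∈ B, ((pulls A a t : ℝ) + 1)⁻¹ := by
  have := Real.log_natCast_nonneg t
  calc (∑ a ∈ B, bonus γ A a t) ^ 2
      ≤ B.card * ∑ a ∈ B, bonus γ A a t ^ 2 := sq_sum_le_card_mul_sum_sq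
    _ = B.card * ∑ a ∈ B, (γ * Real.log t) * ((pulls A a t : ℝ) + 1)⁻¹ := by
        simp_rw [bonus, Real.sq_sqrt (show 0 ≤ γ * Real.log t / ((pulls A _ t : ℝ) + 1) by
          positivity), div_eq_mul_inv]
    _ = _ := by rw [← Finset.mul_sum, ← mul_assoc]

theorem sum_sq_playedBonus_le {A : ℕ → Finset (Fin N)} {m : ℕ}
    (hA : ∀ t, (A (t + 1)).card ≤ m) (T : ℕ) :
    ∑ t ∈ Finset.range T, (∑ a ∈ A (t + 1), bonus γ A a (t + 1)) ^ 2 ≤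
      m * (γ * Real.log T) * (N * (1 + Real.log T)) := by
  have := Real.log_natCast_nonneg T
  calc _ ≤ ∑ t ∈ Finset.range T,
        m * (γ * Real.log T) * ∑ a ∈ A (t + 1), ((pulls A a (t + 1) : ℝ) + 1)⁻¹ := by
        refine Finset.sum_le_sum fun t ht => (sq_sum_bonus_le hγ A _ _).trans ?_
        have hlog : Real.log ((t + 1 : ℕ) : ℝ) ≤ Real.log T :=
          Real.log_le_log (by positivity) (by exact_mod_cast Finset.mem_range.1 ht)
        have := Real.log_natCast_nonneg (t + 1)
        gcongr
        exact hA t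
    _ ≤ _ := by
        rw [← Finset.mul_sum]
        gcongr
        exact sum_inv_pulls_le A T

end Counts

/-! ### Values of super arms -/

namespace SemiBandit

variable {N : ℕ} (I : SemiBandit N)

theorem mean_mem_Icc (a : Fin N) : I.mean a ∈ Set.Icc (0 : ℝ) 1 := by
  have := I.isProb a
  have hint : Integrable (fun x : ℝ => x) (I.law a) :=
    Integrable.of_mem_Icc 0 1 measurable_id.aemeasurable (I.support a)
  refine ⟨integral_nonneg_of_ae ((I.support a).mono fun x hx => hx.1), ?_⟩
  simpa [mean] using
    integral_mono_ae hint (integrable_const 1) ((I.support a).mono fun x hx => hx.2)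

theorem exists_optValue_eq {S : Finset (Finset (Fin N))} (hS : S.Nonempty) :
    ∃ B ∈ S, I.optValue S = I.value B := by
  rw [optValue, dif_pos hS]
  exact Finset.exists_mem_eq_sup' hS _

theorem value_le_optValue {S : Finset (Finset (Fin N))} {B : Finset (Fin N)} (hB : B ∈ S) :
    I.value B ≤ I.optValue S := by
  rw [optValue, dif_pos ⟨B, hB⟩]
  exact Finset.le_sup' I.value hB

theorem value_nonneg (B : Finset (Fin N)) : 0 ≤ I.value B :=
  Finset.sum_nonneg fun a _ => (I.mean_mem_Icc a).1

theorem value_le_card (B : Finset (Fin N)) : I.value B ≤ B.card := by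
  simpa [value] using Finset.sum_le_card_nsmul B I.mean 1 fun a _ => (I.mean_mem_Icc a).2

theorem card_le_maxCard {B : Finset (Fin N)} (hB : B ∈ I.feasible) : B.card ≤ I.maxCard :=
  Finset.le_sup (f := Finset.card) hB

theorem maxCard_le : I.maxCard ≤ N :=
  Finset.sup_le fun B _ => (Finset.card_le_univ B).trans_eq (Fintype.card_fin N)

theorem optValue_sub_value_le_maxCard {S : Finset (Finset (Fin N))} (hS : S.Nonempty)
    (hsub : S ⊆ I.feasible) (B : Finset (Fin N)) : I.optValue S - I.value B ≤ I.maxCard := by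
  obtain ⟨C, hC, hopt⟩ := I.exists_optValue_eq hS
  have hcard : (C.card : ℝ) ≤ I.maxCard := by exact_mod_cast I.card_le_maxCard (hsub hC)
  linarith [I.value_le_card C, I.value_nonneg B]

end SemiBandit

/-! ### Sampled rewards -/

section SampledRewards

variable {N : ℕ} {Ω : Type*} (A : ℕ → Ω → Finset (Fin N)) (X : ℕ → Fin N → Ω → ℝ) (a : Fin N)
  (t : ℕ) (ω : Ω)

/-- The event that the base arm `a` is played in round `s + 1`; it selects the terms of a
`sampledSum`, whose index runs from `0`. -/
def playEvent (s : ℕ) : Set Ω := {ω | a ∈ A (s + 1) ω}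

theorem sum_filter_mem_eq_sampledSum (f : ℕ → Ω → ℝ) :
    ∑ τ ∈ (Finset.Ico 1 (t + 1)).filter (fun τ => a ∈ A τ ω), f τ ω =
      sampledSum (playEvent A a) (fun s => f (s + 1)) t ω := by
  classical
  rw [Finset.sum_filter, Finset.sum_Ico_eq_sum_range, sampledSum]
  simp only [Set.indicator_apply, playEvent, Set.mem_ofPred_eq, add_comm 1, Nat.add_sub_cancel]

theorem cast_pulls_eq_sampledSum :
    (pulls (A · ω) a (t + 1) : ℝ) = sampledSum (playEvent A a) 1 t ω := by
  rw [pulls, Finset.cast_card]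
  exact sum_filter_mem_eq_sampledSum A a t ω fun _ _ => 1

theorem empMean_eq_sampledSum_div : empMean (A · ω) (X · · ω) a (t + 1) =
    sampledSum (playEvent A a) (fun s => X (s + 1) a) t ω / sampledSum (playEvent A a) 1 t ω := by
  rw [empMean, cast_pulls_eq_sampledSum]
  exact congrArg (· / _) (sum_filter_mem_eq_sampledSum A a t ω fun τ => X τ a)

variable {A a t ω}

theorem pulls_mul_empMean_sub (hn : pulls (A · ω) a (t + 1) ≠ 0) (r : ℝ) :
    pulls (A · ω) a (t + 1) * (empMean (A · ω) (X · · ω) a (t + 1) - r) =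
      sampledSum (playEvent A a) (fun s ω => X (s + 1) a ω - r) t ω := by
  rw [← sum_filter_mem_eq_sampledSum A a t ω fun τ ω => X τ a ω - r, mul_sub, empMean,
    mul_div_cancel₀ _ (by exact_mod_cast hn), Finset.sum_sub_distrib]
  simp [pulls]

end SampledRewards

/-- The increment, as the shared seed moves from `K` to `K + 1`, of the perturbed maximum over the
super arms that are available in round `t + 1`. -/
noncomputable def optimisticGap {N : ℕ} {Ω : Type*} (γ K : ℝ) (Θ : ℕ → Ω → Finset (Finset (Fin N)))
    (A : ℕ → Ω → Finset (Fin N)) (X : ℕ → Fin N → Ω → ℝ) (t : ℕ) (ω : Ω) : ℝ :=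
  let M := upperEnvelope (Θ (t + 1) ω) (fun B => ∑ a ∈ B, empMean (A · ω) (X · · ω) a (t + 1))
    fun B => ∑ a ∈ B, bonus γ (A · ω) a (t + 1)
  M (K + 1) - M K

/-- The total bonus of the super arm that is played in round `t + 1`. -/
noncomputable def playedBonus {N : ℕ} {Ω : Type*} (γ : ℝ) (A : ℕ → Ω → Finset (Fin N)) (t : ℕ)
    (ω : Ω) : ℝ :=
  ∑ a ∈ A (t + 1) ω, bonus γ (A · ω) a (t + 1)

theorem playedBonus_nonneg {N : ℕ} {Ω : Type*} (γ : ℝ) (A : ℕ → Ω → Finset (Fin N)) (t : ℕ)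
    (ω : Ω) : 0 ≤ playedBonus γ A t ω :=
  Finset.sum_nonneg fun _ _ => bonus_nonneg _ _ _ _

/-- The seed from which on the perturbation dominates, with high probability, the estimation errors:
at this value `optimismLevel γ * bonus` is the confidence radius `√(3 log t / (n + 1))`. -/
noncomputable def optimismLevel (γ : ℝ) : ℝ := Real.sqrt (3 / γ)

theorem optimismLevel_nonneg (γ : ℝ) : 0 ≤ optimismLevel γ := Real.sqrt_nonneg _

theorem optimismLevel_mul_bonus {N : ℕ} {γ : ℝ} (hγ : 0 < γ) (A : ℕ → Finset (Fin N)) (a : Fin N)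
    (t : ℕ) : optimismLevel γ * bonus γ A a t =
      Real.sqrt (3 * Real.log t / ((pulls A a t : ℝ) + 1)) := by
  rw [optimismLevel, bonus, ← Real.sqrt_mul (by positivity)]
  congr 1
  field_simp

theorem exp_neg_sq_sqrt_log_le {n : ℕ} (hn : n ≠ 0) {x : ℝ} (hx : 1 ≤ x) :
    Real.exp (-(2 * n * Real.sqrt (3 * Real.log x / (n + 1)) ^ 2)) ≤ (x ^ 3)⁻¹ := by
  have hlog := Real.log_nonneg hx
  have hn' : (1 : ℝ) ≤ n := by exact_mod_cast Nat.one_le_iff_ne_zero.2 hn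
  have hexp : 3 * Real.log x ≤ 2 * n * Real.sqrt (3 * Real.log x / (n + 1)) ^ 2 := by
    rw [Real.sq_sqrt (by positivity), mul_div_assoc', le_div_iff₀ (by positivity)]
    nlinarith
  calc _ ≤ Real.exp (-(3 * Real.log x)) := Real.exp_le_exp.2 (neg_le_neg hexp)
    _ = (x ^ 3)⁻¹ := by
        rw [Real.exp_neg, mul_comm, Real.exp_mul, Real.exp_log (by positivity)]
        norm_cast

/-- The outcomes on which the estimation error of `a` in round `t` exceeds its perturbation at the
seed `optimismLevel γ`. -/
def badEvent {N : ℕ} {Ω : Type*} (I : SemiBandit N) (γ : ℝ) (A : ℕ → Ω → Finset (Fin N))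
    (X : ℕ → Fin N → Ω → ℝ) (a : Fin N) (t : ℕ) : Set Ω :=
  {ω | optimismLevel γ * bonus γ (A · ω) a t < |empMean (A · ω) (X · · ω) a t - I.mean a|}

theorem pulls_ne_zero_of_mem_badEvent {N : ℕ} {Ω : Type*} {I : SemiBandit N} {γ : ℝ} (hγ : 0 < γ)
    {A : ℕ → Ω → Finset (Fin N)} {X : ℕ → Fin N → Ω → ℝ} {a : Fin N} {t : ℕ} (ht : 2 ≤ t) {ω : Ω}
    (hω : ω ∈ badEvent I γ A X a t) : pulls (A · ω) a t ≠ 0 := by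
  intro h0
  rw [badEvent, Set.mem_ofPred_eq, optimismLevel_mul_bonus hγ, empMean, h0] at hω
  simp only [Nat.cast_zero, div_zero, zero_sub, abs_neg, zero_add, div_one] at hω
  have hmean : |I.mean a| ≤ 1 := abs_le.2
    ⟨by linarith [(I.mean_mem_Icc a).1], (I.mean_mem_Icc a).2⟩
  have hlog : Real.log 2 ≤ Real.log t := Real.log_le_log two_pos (by exact_mod_cast ht)
  have hradius : 1 ≤ Real.sqrt (3 * Real.log t) :=
    Real.one_le_sqrt.2 (by linarith [Real.log_two_gt_d9])
  linarith

namespace IsCLSGRun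

variable {N : ℕ} {I : SemiBandit N} {γ : ℝ} {Ω : Type*} [mΩ : MeasurableSpace Ω]
  {μ : Measure Ω} {𝓕 : Filtration ℕ mΩ} {Θ : ℕ → Ω → Finset (Finset (Fin N))}
  {w : ℕ → Ω → ℝ} {A : ℕ → Ω → Finset (Fin N)} {X : ℕ → Fin N → Ω → ℝ}
  (h : IsCLSGRun I γ μ 𝓕 Θ w A X)

include h

/-! ### Laws and measurability along a run -/

theorem measurable_seed (t : ℕ) : Measurable (w (t + 1)) := (h.seed_meas t).mono (𝓕.le _) le_rfl

theorem measurable_reward (t : ℕ) (a : Fin N) : Measurable (X (t + 1) a) :=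
  (h.reward_meas t a).mono (𝓕.le _) le_rfl

theorem hasLaw_seed (t : ℕ) : HasLaw (w (t + 1)) (gaussianReal 0 1) μ :=
  ⟨(h.measurable_seed t).aemeasurable, h.seed_law t⟩

theorem hasLaw_reward (t : ℕ) (a : Fin N) : HasLaw (X (t + 1) a) (I.law a) μ :=
  ⟨(h.measurable_reward t a).aemeasurable, h.reward_law t a⟩

theorem isProbabilityMeasure : IsProbabilityMeasure μ := (h.hasLaw_seed 0).isProbabilityMeasure

theorem ae_reward_mem_Icc : ∀ᵐ ω ∂μ, ∀ a t, X (t + 1) a ω ∈ Set.Icc (0 : ℝ) 1 := by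
  refine ae_all_iff.2 fun a => ae_all_iff.2 fun t => ?_
  exact ((h.hasLaw_reward t a).ae_iff (measurableSet_setOfPred.1 measurableSet_Icc)).2 (I.support a)

theorem measurableSet_playEvent (a : Fin N) (s : ℕ) :
    MeasurableSet[𝓕 (s + 1)] (playEvent A a s) :=
  measurableSet_of_index (h.play_meas s) (a ∈ ·)

theorem measurable_pulls (a : Fin N) (t : ℕ) :
    Measurable[𝓕 t] fun ω => (pulls (A · ω) a (t + 1) : ℝ) := by
  simp only [cast_pulls_eq_sampledSum]
  exact measurable_sampledSum
    (fun s => measurable_const.indicator (h.measurableSet_playEvent a s)) t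

theorem measurable_empMean (a : Fin N) (t : ℕ) :
    Measurable[𝓕 t] fun ω => empMean (A · ω) (X · · ω) a (t + 1) := by
  simp only [empMean_eq_sampledSum_div, ← cast_pulls_eq_sampledSum]
  exact (measurable_sampledSum
    (fun s => (h.reward_meas s a).indicator (h.measurableSet_playEvent a s)) t).div
    (h.measurable_pulls a t)

theorem measurable_bonus (a : Fin N) (t : ℕ) :
    Measurable[𝓕 t] fun ω => bonus γ (A · ω) a (t + 1) :=
  (measurable_const.div ((h.measurable_pulls a t).add measurable_const)).sqrt

theorem measurable_optimisticGap (K : ℝ) (t : ℕ) :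
    Measurable[𝓕 t] (optimisticGap γ K Θ A X t) :=
  have hM : ∀ _, Measurable[𝓕 t] _ := measurable_upperEnvelope (h.avail_meas t)
    (fun B => Finset.measurable_fun_sum B fun a _ => h.measurable_empMean a t)
    (fun B => Finset.measurable_fun_sum B fun a _ => h.measurable_bonus a t)
  (hM (K + 1)).sub (hM K)

theorem measurable_playedBonus (t : ℕ) : Measurable (playedBonus γ A t) :=
  measurable_apply_index (g := fun B ω => ∑ a ∈ B, bonus γ (A · ω) a (t + 1))
    (fun B => 𝓕.le _ _ (h.play_meas t B)) fun B =>
    Finset.measurable_fun_sum B fun a _ => (h.measurable_bonus a t).mono (𝓕.le _) le_rfl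

theorem measurableSet_badEvent (a : Fin N) (t : ℕ) :
    MeasurableSet (badEvent I γ A X a (t + 1)) :=
  measurableSet_lt (((h.measurable_bonus a t).mono (𝓕.le _) le_rfl).const_mul _)
    ((((h.measurable_empMean a t).mono (𝓕.le _) le_rfl).sub_const _).abs)

/-! ### Concentration of the empirical means -/

/-- The information on which the decision of round `t + 1` is based, together with that decision:
the rewards of round `t + 1` are independent of it. -/
def decisionFiltration : Filtration ℕ mΩ where
  seq t := 𝓕 t ⊔ MeasurableSpace.comap (w (t + 1)) inferInstance ⊔
    MeasurableSpace.comap (A (t + 1)) ⊤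
  mono' := by
    refine monotone_nat_of_le_succ fun t => le_trans ?_ (le_sup_of_le_left le_sup_left)
    refine sup_le (sup_le (𝓕.mono t.le_succ) (h.seed_meas t).comap_le) ?_
    rintro _ ⟨s, -, rfl⟩
    exact measurableSet_of_index (h.play_meas t) (· ∈ s)
  le' t := by
    refine sup_le (sup_le (𝓕.le t) (h.measurable_seed t).comap_le) ?_
    rintro _ ⟨s, -, rfl⟩
    exact 𝓕.le _ _ (measurableSet_of_index (h.play_meas t) (· ∈ s))

theorem hasSubgaussianMGF_reward_sub_mean (t : ℕ) (a : Fin N) :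
    HasSubgaussianMGF (fun ω => X (t + 1) a ω - I.mean a) (1 / 4) μ := by
  have := h.isProbabilityMeasure
  have hsub := hasSubgaussianMGF_of_mem_Icc (h.measurable_reward t a).aemeasurable
    (h.ae_reward_mem_Icc.mono fun ω hω => hω a t)
  rw [(h.hasLaw_reward t a).integral_eq] at hsub
  convert! hsub using 1
  norm_num [div_pow]

theorem measure_abs_empMean_sub_ge_le (a : Fin N) (t : ℕ) {n : ℕ} (hn : n ≠ 0) {ε : ℝ}
    (hε : 0 ≤ ε) :
    μ {ω | pulls (A · ω) a (t + 1) = n ∧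
        ε ≤ |empMean (A · ω) (X · · ω) a (t + 1) - I.mean a|} ≤
      2 * ENNReal.ofReal (Real.exp (-(2 * n * ε ^ 2))) := by
  have := h.isProbabilityMeasure
  have hn' : (n : ℝ) ≠ 0 := by exact_mod_cast hn
  have htail := measure_abs_sampledSum_ge_le (μ := μ) (𝓖 := h.decisionFiltration)
    (P := playEvent A a) (Y := fun s ω => X (s + 1) a ω - I.mean a) (c := 1 / 4) (x := n * ε)
    (fun s => (le_sup_right : MeasurableSpace.comap (A (s + 1)) ⊤ ≤ _) _
      ⟨{B | a ∈ B}, trivial, rfl⟩)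
    (fun s => ((h.reward_meas s a).sub_const _).mono (le_sup_of_le_left le_sup_left) le_rfl)
    (fun s => h.hasSubgaussianMGF_reward_sub_mean s a)
    (fun s => indep_of_indep_of_le_left (h.reward_indep s)
      (((measurable_pi_apply a).sub_const (I.mean a)).comp
        (comap_measurable fun ω a => X (s + 1) a ω)).comap_le)
    (by norm_num) hn (by positivity) t
  refine (measure_mono ?_).trans (htail.trans_eq ?_)
  · rintro ω ⟨hpulls, hdev⟩
    refine ⟨by rw [← cast_pulls_eq_sampledSum, hpulls], ?_⟩
    rw [← pulls_mul_empMean_sub X (hpulls.trans_ne hn), abs_mul, Nat.abs_cast, hpulls]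
    gcongr
  · congr 4
    push_cast
    field_simp
    ring

theorem measureReal_badEvent_le (hγ : 0 < γ) (a : Fin N) (t : ℕ) :
    μ.real (badEvent I γ A X a (t + 1)) ≤ 2 / ((t : ℝ) + 1) ^ 2 := by
  have := h.isProbabilityMeasure
  rcases Nat.eq_zero_or_pos t with rfl | ht
  · exact measureReal_le_one.trans (by norm_num)
  set ε : ℕ → ℝ := fun n => Real.sqrt (3 * Real.log (t + 1 : ℕ) / (n + 1))
  set E : ℕ → Set Ω := fun n => {ω | pulls (A · ω) a (t + 1) = n ∧
    ε n ≤ |empMean (A · ω) (X · · ω) a (t + 1) - I.mean a|}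
  have hcover : badEvent I γ A X a (t + 1) ⊆ ⋃ n ∈ Finset.Icc 1 t, E n := by
    intro ω hω
    have hn := pulls_ne_zero_of_mem_badEvent hγ (by omega) hω
    rw [badEvent, Set.mem_ofPred_eq, optimismLevel_mul_bonus hγ] at hω
    exact Set.mem_biUnion (Finset.mem_coe.2 (Finset.mem_Icc.2
      ⟨Nat.pos_of_ne_zero hn, pulls_succ_le _ a t⟩)) ⟨rfl, hω.le⟩
  have hterm : ∀ n ∈ Finset.Icc 1 t, μ (E n) ≤ ENNReal.ofReal (2 * (((t : ℝ) + 1) ^ 3)⁻¹) := by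
    intro n hn
    have hn0 : n ≠ 0 := Nat.one_le_iff_ne_zero.1 (Finset.mem_Icc.1 hn).1
    refine (h.measure_abs_empMean_sub_ge_le a t hn0 (Real.sqrt_nonneg _)).trans ?_
    rw [← ENNReal.ofReal_ofNat, ← ENNReal.ofReal_mul (by norm_num)]
    gcongr
    simpa using exp_neg_sq_sqrt_log_le hn0 (x := (t + 1 : ℕ)) (by simp)
  refine ENNReal.toReal_le_of_le_ofReal (by positivity) ?_
  calc μ (badEvent I γ A X a (t + 1))
      ≤ ∑ n ∈ Finset.Icc 1 t, ENNReal.ofReal (2 * (((t : ℝ) + 1) ^ 3)⁻¹) :=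
        (measure_mono hcover).trans
          ((measure_biUnion_finset_le _ _).trans (Finset.sum_le_sum hterm))
    _ = ENNReal.ofReal (t * (2 * (((t : ℝ) + 1) ^ 3)⁻¹)) := by
        rw [Finset.sum_const, Nat.card_Icc, Nat.add_sub_cancel, nsmul_eq_mul,
          ENNReal.ofReal_mul (Nat.cast_nonneg _), ENNReal.ofReal_natCast]
    _ ≤ ENNReal.ofReal (2 / ((t : ℝ) + 1) ^ 2) := by
        refine ENNReal.ofReal_le_ofReal ?_
        rw [← div_eq_mul_inv, mul_div_assoc', div_le_div_iff₀ (by positivity) (by positivity)]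
        nlinarith [pow_pos (by positivity : (0 : ℝ) < t + 1) 2]

end IsCLSGRun

/-! ### The regret of one round -/

section RoundRegret

variable {N : ℕ} {Ω : Type*} {γ K : ℝ} {Θ : ℕ → Ω → Finset (Finset (Fin N))}
  {A : ℕ → Ω → Finset (Fin N)} {X : ℕ → Fin N → Ω → ℝ} {t : ℕ} {ω : Ω}

theorem sum_perturbed (γ : ℝ) (A : ℕ → Finset (Fin N)) (X : ℕ → Fin N → ℝ) (x : ℝ) (t : ℕ)
    (B : Finset (Fin N)) : ∑ a ∈ B, perturbed γ A X x a t =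
      ∑ a ∈ B, empMean A X a t + x * ∑ a ∈ B, bonus γ A a t := by
  rw [Finset.mul_sum, ← Finset.sum_add_distrib]
  rfl

theorem optimisticGap_nonneg : 0 ≤ optimisticGap γ K Θ A X t ω :=
  sub_nonneg.2 (monotone_upperEnvelope
    (fun _ _ => Finset.sum_nonneg fun _ _ => bonus_nonneg _ _ _ _) (by linarith))

theorem optimisticGap_le (hγ : 0 ≤ γ) (hΘ : (Θ (t + 1) ω).Nonempty) :
    optimisticGap γ K Θ A X t ω ≤ N * Real.sqrt (γ * Real.log (t + 1 : ℕ)) := by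
  simpa only [optimisticGap, add_sub_cancel_left, one_mul] using
    upperEnvelope_sub_le_mul (x := K) (y := K + 1) hΘ
      (fun B _ => sum_bonus_le hγ (A · ω) B (t + 1)) (by linarith)

end RoundRegret

/-- The factor of the played bonus in the bound for the expected regret of one round. -/
noncomputable def regretFactor (γ : ℝ) : ℝ :=
  optimismLevel γ + (optimismLevel γ + 1) /
    (gaussianReal 0 1).real (Set.Ioi (optimismLevel γ + 1))

namespace IsCLSGRun

variable {N : ℕ} {I : SemiBandit N} {γ : ℝ} {Ω : Type*} [mΩ : MeasurableSpace Ω]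
  {μ : Measure Ω} {𝓕 : Filtration ℕ mΩ} {Θ : ℕ → Ω → Finset (Finset (Fin N))}
  {w : ℕ → Ω → ℝ} {A : ℕ → Ω → Finset (Fin N)} {X : ℕ → Fin N → Ω → ℝ}
  (h : IsCLSGRun I γ μ 𝓕 Θ w A X)

include h

theorem integrable_comp_seed (t : ℕ) {φ : ℝ → ℝ} (hφ : Integrable φ (gaussianReal 0 1)) :
    Integrable (fun ω => φ (w (t + 1) ω)) μ :=
  Integrable.comp_measurable ((h.seed_law t).symm ▸ hφ) (h.measurable_seed t)

theorem integral_comp_seed_mul (t : ℕ) {φ : ℝ → ℝ} (hφ : Measurable φ) {g : Ω → ℝ}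
    (hg : Measurable[𝓕 t] g) :
    ∫ ω, φ (w (t + 1) ω) * g ω ∂μ = (∫ x, φ x ∂gaussianReal 0 1) * ∫ ω, g ω ∂μ := by
  have hind : IndepFun (φ ∘ w (t + 1)) g μ :=
    indep_of_indep_of_le_left (indep_of_indep_of_le_right (h.seed_indep t) hg.comap_le)
      (hφ.comp (comap_measurable (w (t + 1)))).comap_le
  rw [← (h.hasLaw_seed t).integral_comp hφ.aestronglyMeasurable]
  exact hind.integral_fun_mul_eq_mul_integral
    (hφ.comp (h.measurable_seed t)).aestronglyMeasurable
    (hg.mono (𝓕.le t) le_rfl).aestronglyMeasurable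

theorem sum_empMean_add_seed_mul_le (t : ℕ) (ω : Ω) :
    ∀ B ∈ Θ (t + 1) ω, ∑ a ∈ B, empMean (A · ω) (X · · ω) a (t + 1) +
        w (t + 1) ω * ∑ a ∈ B, bonus γ (A · ω) a (t + 1) ≤
      ∑ a ∈ A (t + 1) ω, empMean (A · ω) (X · · ω) a (t + 1) +
        w (t + 1) ω * ∑ a ∈ A (t + 1) ω, bonus γ (A · ω) a (t + 1) := by
  simpa only [sum_perturbed] using h.play_max t ω

theorem optimisticGap_le_playedBonus {K : ℝ} {t : ℕ} {ω : Ω} (hw : K + 1 < w (t + 1) ω) :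
    optimisticGap γ K Θ A X t ω ≤ playedBonus γ A t ω := by
  simpa only [optimisticGap, playedBonus, add_sub_cancel_left, one_mul] using
    upperEnvelope_sub_le_mul_of_maximal (x := K) (by linarith) hw (h.play_mem t ω)
      (h.sum_empMean_add_seed_mul_le t ω)

theorem integrable_mul_playedBonus (hγ : 0 ≤ γ) (t : ℕ) {f : Ω → ℝ} (hf : Integrable f μ) :
    Integrable (fun ω => f ω * playedBonus γ A t ω) μ :=
  hf.mul_bdd (h.measurable_playedBonus t).aestronglyMeasurable (.of_forall fun ω =>
    (Real.norm_of_nonneg (playedBonus_nonneg γ A t ω)).trans_le (sum_bonus_le hγ _ _ _))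

theorem integrable_playedBonus (hγ : 0 ≤ γ) (t : ℕ) : Integrable (playedBonus γ A t) μ := by
  have := h.isProbabilityMeasure
  simpa using h.integrable_mul_playedBonus hγ t (integrable_const 1)

theorem integrable_mul_optimisticGap (hγ : 0 ≤ γ) (K : ℝ) (t : ℕ) {f : Ω → ℝ}
    (hf : Integrable f μ) : Integrable (fun ω => f ω * optimisticGap γ K Θ A X t ω) μ :=
  hf.mul_bdd ((h.measurable_optimisticGap K t).mono (𝓕.le t) le_rfl).aestronglyMeasurable
    (.of_forall fun ω => (Real.norm_of_nonneg optimisticGap_nonneg).trans_le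
      (optimisticGap_le hγ (h.avail_nonempty t ω)))

/-- A seed above `K + 1` is drawn with constant probability and independently of the past; it turns
the optimistic gap into a bonus that is actually played. -/
theorem gaussianReal_Ioi_mul_integral_optimisticGap_le (hγ : 0 ≤ γ) (K : ℝ) (t : ℕ) :
    (gaussianReal 0 1).real (Set.Ioi (K + 1)) * ∫ ω, optimisticGap γ K Θ A X t ω ∂μ ≤
      ∫ ω, playedBonus γ A t ω ∂μ := by
  have hφ : Measurable ((Set.Ioi (K + 1)).indicator (1 : ℝ → ℝ)) :=
    measurable_one.indicator measurableSet_Ioi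
  rw [← integral_indicator_one measurableSet_Ioi,
    ← h.integral_comp_seed_mul t hφ (h.measurable_optimisticGap K t)]
  refine integral_mono_of_nonneg (.of_forall fun ω => mul_nonneg
    (Set.indicator_nonneg (fun _ _ => zero_le_one) _) optimisticGap_nonneg)
    (h.integrable_playedBonus hγ t) (.of_forall fun ω => ?_)
  by_cases hw : w (t + 1) ω ∈ Set.Ioi (K + 1)
  · simpa only [Set.indicator_of_mem hw, Pi.one_apply, one_mul] using
      h.optimisticGap_le_playedBonus hw
  · simpa only [Set.indicator_of_notMem hw, zero_mul] using playedBonus_nonneg γ A t ω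

theorem integral_max_sub_seed_mul_optimisticGap_le (hγ : 0 ≤ γ) {K : ℝ} (hK : 0 ≤ K) (t : ℕ) :
    ∫ ω, max (K - w (t + 1) ω) 0 * optimisticGap γ K Θ A X t ω ∂μ ≤
      (K + 1) / (gaussianReal 0 1).real (Set.Ioi (K + 1)) * ∫ ω, playedBonus γ A t ω ∂μ := by
  have hp := gaussianReal_real_Ioi_pos 0 one_ne_zero (K + 1)
  have hseed : ∫ x, max (K - x) 0 ∂gaussianReal 0 1 ≤ K + 1 := by
    simpa using integral_max_sub_gaussianReal_zero_le hK 1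
  have hgap : ∫ ω, optimisticGap γ K Θ A X t ω ∂μ ≤
      (∫ ω, playedBonus γ A t ω ∂μ) / (gaussianReal 0 1).real (Set.Ioi (K + 1)) :=
    (le_div_iff₀' hp).2 (h.gaussianReal_Ioi_mul_integral_optimisticGap_le hγ K t)
  have hgap0 : 0 ≤ ∫ ω, optimisticGap γ K Θ A X t ω ∂μ :=
    integral_nonneg fun _ => optimisticGap_nonneg
  rw [h.integral_comp_seed_mul t (φ := fun x => max (K - x) 0) (by fun_prop)
    (h.measurable_optimisticGap K t)]
  calc _ ≤ (K + 1) * ((∫ ω, playedBonus γ A t ω ∂μ) /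
        (gaussianReal 0 1).real (Set.Ioi (K + 1))) :=
        mul_le_mul hseed hgap hgap0 (by linarith)
    _ = _ := by ring

theorem abs_sum_empMean_sub_value_le (t : ℕ) :
    ∀ᵐ ω ∂μ, ∀ B, |∑ a ∈ B, empMean (A · ω) (X · · ω) a (t + 1) - I.value B| ≤
      optimismLevel γ * ∑ a ∈ B, bonus γ (A · ω) a (t + 1) +
        ∑ a, (badEvent I γ A X a (t + 1)).indicator 1 ω := by
  filter_upwards [h.ae_reward_mem_Icc] with ω hω B
  have harm : ∀ a, |empMean (A · ω) (X · · ω) a (t + 1) - I.mean a| ≤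
      optimismLevel γ * bonus γ (A · ω) a (t + 1) +
        (badEvent I γ A X a (t + 1)).indicator 1 ω := by
    intro a
    by_cases hbad : ω ∈ badEvent I γ A X a (t + 1)
    · have hemp := empMean_mem_Icc (A := (A · ω)) (X := (X · · ω)) (hω a) (t + 1)
      have hmean := I.mean_mem_Icc a
      have hbonus := mul_nonneg (optimismLevel_nonneg γ) (bonus_nonneg γ (A · ω) a (t + 1))
      rw [Set.indicator_of_mem hbad, Pi.one_apply, abs_le]
      constructor <;> linarith [hemp.1, hemp.2, hmean.1, hmean.2]
    · rw [Set.indicator_of_notMem hbad, add_zero]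
      exact not_lt.1 hbad
  calc _ ≤ ∑ a ∈ B, |empMean (A · ω) (X · · ω) a (t + 1) - I.mean a| := by
        rw [SemiBandit.value, ← Finset.sum_sub_distrib]
        exact Finset.abs_sum_le_sum_abs _ _
    _ ≤ ∑ a ∈ B, (optimismLevel γ * bonus γ (A · ω) a (t + 1) +
          (badEvent I γ A X a (t + 1)).indicator 1 ω) := Finset.sum_le_sum fun a _ => harm a
    _ ≤ _ := by
        rw [Finset.sum_add_distrib, ← Finset.mul_sum]
        gcongr
        · exact fun _ _ _ => Set.indicator_nonneg (fun _ _ => zero_le_one (α := ℝ)) _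
        · exact B.subset_univ

theorem optValue_sub_value_le (t : ℕ) :
    ∀ᵐ ω ∂μ, I.optValue (Θ (t + 1) ω) - I.value (A (t + 1) ω) ≤
      (|w (t + 1) ω| + optimismLevel γ) * playedBonus γ A t ω +
      max (optimismLevel γ - w (t + 1) ω) 0 * optimisticGap γ (optimismLevel γ) Θ A X t ω +
      2 * ∑ a, (badEvent I γ A X a (t + 1)).indicator 1 ω := by
  filter_upwards [h.abs_sum_empMean_sub_value_le t] with ω hdev
  obtain ⟨B, hB, hopt⟩ := I.exists_optValue_eq (h.avail_nonempty t ω)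
  rw [hopt]
  exact sub_le_of_abs_sub_le_of_maximal
    (fun _ _ => Finset.sum_nonneg fun _ _ => bonus_nonneg _ _ _ _) (fun B _ => hdev B)
    (h.play_mem t ω) hB (h.sum_empMean_add_seed_mul_le t ω)

theorem integrable_indicator_badEvent (a : Fin N) (t : ℕ) :
    Integrable ((badEvent I γ A X a (t + 1)).indicator (1 : Ω → ℝ)) μ := by
  have := h.isProbabilityMeasure
  exact (integrable_const (1 : ℝ)).indicator (h.measurableSet_badEvent a t)

theorem integral_sum_badEvent_le (hγ : 0 < γ) (t : ℕ) :
    ∫ ω, ∑ a, (badEvent I γ A X a (t + 1)).indicator (1 : Ω → ℝ) ω ∂μ ≤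
      2 * N * (((t : ℝ) + 1) ^ 2)⁻¹ := by
  rw [integral_finsetSum _ fun a _ => h.integrable_indicator_badEvent a t]
  simp only [integral_indicator_one (h.measurableSet_badEvent _ t)]
  refine (Finset.sum_le_card_nsmul _ _ _ fun a _ => h.measureReal_badEvent_le hγ a t).trans_eq ?_
  rw [Finset.card_univ, Fintype.card_fin, nsmul_eq_mul]
  ring

theorem integral_optValue_sub_value_le (hγ : 0 < γ) (t : ℕ) :
    ∫ ω, (I.optValue (Θ (t + 1) ω) - I.value (A (t + 1) ω)) ∂μ ≤
      ∫ ω, (|w (t + 1) ω| + regretFactor γ) * playedBonus γ A t ω ∂μ +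
      4 * N * (((t : ℝ) + 1) ^ 2)⁻¹ := by
  have := h.isProbabilityMeasure
  set K := optimismLevel γ
  set p := (gaussianReal 0 1).real (Set.Ioi (K + 1))
  have iplayed : Integrable (fun ω => (|w (t + 1) ω| + K) * playedBonus γ A t ω) μ :=
    h.integrable_mul_playedBonus hγ.le t
      ((h.integrable_comp_seed t (integrable_abs_gaussianReal 0 1)).add (integrable_const K))
  have igap : Integrable
      (fun ω => max (K - w (t + 1) ω) 0 * optimisticGap γ K Θ A X t ω) μ :=
    h.integrable_mul_optimisticGap hγ.le K t
      (h.integrable_comp_seed t (integrable_max_sub_gaussianReal 0 1 K))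
  have ibad : Integrable
      (fun ω => 2 * ∑ a, (badEvent I γ A X a (t + 1)).indicator (1 : Ω → ℝ) ω) μ :=
    (integrable_finsetSum _ fun a _ => h.integrable_indicator_badEvent a t).const_mul 2
  have hfactor : ∫ ω, (|w (t + 1) ω| + regretFactor γ) * playedBonus γ A t ω ∂μ =
      ∫ ω, (|w (t + 1) ω| + K) * playedBonus γ A t ω ∂μ +
        (K + 1) / p * ∫ ω, playedBonus γ A t ω ∂μ := by
    rw [← integral_const_mul,
      ← integral_add iplayed ((h.integrable_playedBonus hγ.le t).const_mul _)]
    exact integral_congr_ae (.of_forall fun ω => by simp only [regretFactor, K, p]; ring)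
  calc _ ≤ ∫ ω, ((|w (t + 1) ω| + K) * playedBonus γ A t ω +
          max (K - w (t + 1) ω) 0 * optimisticGap γ K Θ A X t ω +
          2 * ∑ a, (badEvent I γ A X a (t + 1)).indicator 1 ω) ∂μ :=
        integral_mono_of_nonneg
          (.of_forall fun ω => sub_nonneg.2 (I.value_le_optValue (h.play_mem t ω)))
          ((iplayed.add igap).add ibad) (h.optValue_sub_value_le t)
    _ = ∫ ω, (|w (t + 1) ω| + K) * playedBonus γ A t ω ∂μ +
          ∫ ω, max (K - w (t + 1) ω) 0 * optimisticGap γ K Θ A X t ω ∂μ +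
          2 * ∫ ω, ∑ a, (badEvent I γ A X a (t + 1)).indicator 1 ω ∂μ := by
        rw [integral_add (by exact iplayed.add igap) ibad, integral_add iplayed igap,
          integral_const_mul]
    _ ≤ _ := by
        rw [hfactor]
        linarith [h.integral_max_sub_seed_mul_optimisticGap_le hγ.le (optimismLevel_nonneg γ) t,
          h.integral_sum_badEvent_le hγ t]

end IsCLSGRun

/-! ### Upper bound -/

theorem regret_eq_sum_range {N : ℕ} (I : SemiBandit N) {Ω : Type*} [MeasurableSpace Ω]
    (μ : Measure Ω) (Θ : ℕ → Ω → Finset (Finset (Fin N))) (A : ℕ → Ω → Finset (Fin N)) (T : ℕ) :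
    regret I μ Θ A T =
      ∑ t ∈ Finset.range T, ∫ ω, (I.optValue (Θ (t + 1) ω) - I.value (A (t + 1) ω)) ∂μ := by
  rw [regret, Finset.range_eq_Ico, Finset.sum_Ico_add'
    (fun t => ∫ ω, (I.optValue (Θ t ω) - I.value (A t ω)) ∂μ), zero_add,
    Finset.Ico_add_one_right_eq_Icc]

theorem sum_range_inv_sq_le (T : ℕ) : ∑ t ∈ Finset.range T, (((t : ℝ) + 1) ^ 2)⁻¹ ≤ 2 := by
  calc _ = ∑ i ∈ Finset.Ioo 0 (T + 1), ((i : ℝ) ^ 2)⁻¹ := by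
        rw [← Finset.Ico_add_one_left_eq_Ioo, Finset.range_eq_Ico,
          ← Finset.sum_Ico_add' (fun i : ℕ => ((i : ℝ) ^ 2)⁻¹)]
        simp only [Nat.cast_add, Nat.cast_one]
    _ ≤ 2 := by simpa using sum_Ioo_inv_sq_le (α := ℝ) 0 (T + 1)

theorem add_mul_le_add_sq_add_sq_div {η : ℝ} (hη : 0 < η) (a b c : ℝ) :
    (a + b) * c ≤ η * (a ^ 2 + b ^ 2) + c ^ 2 / (2 * η) := by
  have : 0 ≤ (η * (a - b) ^ 2 + (η * (a + b) - c) ^ 2 / η) / 2 := by positivity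
  have : η * (a ^ 2 + b ^ 2) + c ^ 2 / (2 * η) - (a + b) * c =
      (η * (a - b) ^ 2 + (η * (a + b) - c) ^ 2 / η) / 2 := by
    field_simp
    ring
  linarith

namespace IsCLSGRun

variable {N : ℕ} {I : SemiBandit N} {γ : ℝ} {Ω : Type*} [mΩ : MeasurableSpace Ω]
  {μ : Measure Ω} {𝓕 : Filtration ℕ mΩ} {Θ : ℕ → Ω → Finset (Finset (Fin N))}
  {w : ℕ → Ω → ℝ} {A : ℕ → Ω → Finset (Fin N)} {X : ℕ → Fin N → Ω → ℝ}
  (h : IsCLSGRun I γ μ 𝓕 Θ w A X)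

include h

theorem integrable_sq_playedBonus (hγ : 0 ≤ γ) (t : ℕ) :
    Integrable (fun ω => playedBonus γ A t ω ^ 2) μ := by
  simpa only [sq] using h.integrable_mul_playedBonus hγ t (h.integrable_playedBonus hγ t)

theorem integral_abs_seed_add_mul_playedBonus_le (hγ : 0 ≤ γ) (L : ℝ) {η : ℝ} (hη : 0 < η)
    (t : ℕ) : ∫ ω, (|w (t + 1) ω| + L) * playedBonus γ A t ω ∂μ ≤
      η * (1 + L ^ 2) + (∫ ω, playedBonus γ A t ω ^ 2 ∂μ) / (2 * η) := by
  have := h.isProbabilityMeasure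
  have isq : Integrable (fun ω => w (t + 1) ω ^ 2) μ :=
    h.integrable_comp_seed t (φ := (· ^ 2)) (memLp_id_gaussianReal 2).integrable_sq
  have iseed : Integrable (fun ω => η * (w (t + 1) ω ^ 2 + L ^ 2)) μ :=
    (isq.add (integrable_const _)).const_mul η
  have ibonus := (h.integrable_sq_playedBonus hγ t).div_const (2 * η)
  have hsq : ∫ ω, w (t + 1) ω ^ 2 ∂μ = 1 := by
    have hlaw := (h.hasLaw_seed t).integral_comp (f := (· ^ 2))
      (measurable_id.pow_const 2).aestronglyMeasurable
    exact hlaw.trans (integral_sq_gaussianReal_zero 1)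
  calc _ ≤ ∫ ω, (η * (w (t + 1) ω ^ 2 + L ^ 2) + playedBonus γ A t ω ^ 2 / (2 * η)) ∂μ := by
        refine integral_mono (h.integrable_mul_playedBonus hγ t
          ((h.integrable_comp_seed t (integrable_abs_gaussianReal 0 1)).add (integrable_const L)))
          (iseed.add ibonus) fun ω => ?_
        simpa only [sq_abs] using
          add_mul_le_add_sq_add_sq_div hη |w (t + 1) ω| L (playedBonus γ A t ω)
    _ = _ := by
        rw [integral_add iseed ibonus, integral_const_mul, integral_add isq (integrable_const _),
          hsq, integral_div]
        simp

theorem sum_integral_sq_playedBonus_le (hγ : 0 ≤ γ) (T : ℕ) :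
    ∑ t ∈ Finset.range T, ∫ ω, playedBonus γ A t ω ^ 2 ∂μ ≤
      I.maxCard * (γ * Real.log T) * (N * (1 + Real.log T)) := by
  have := h.isProbabilityMeasure
  rw [← integral_finsetSum _ fun t _ => h.integrable_sq_playedBonus hγ t]
  refine (integral_mono (integrable_finsetSum _ fun t _ => h.integrable_sq_playedBonus hγ t)
    (integrable_const (I.maxCard * (γ * Real.log T) * (N * (1 + Real.log T))))
    fun ω => ?_).trans (by simp)
  exact sum_sq_playedBonus_le hγ
    (fun t => I.card_le_maxCard (h.avail_subset t ω (h.play_mem t ω))) T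

theorem regret_le_of_pos (hγ : 0 < γ) {η : ℝ} (hη : 0 < η) (T : ℕ) :
    regret I μ Θ A T ≤ η * (1 + regretFactor γ ^ 2) * T +
      I.maxCard * (γ * Real.log T) * (N * (1 + Real.log T)) / (2 * η) + 8 * N := by
  rw [regret_eq_sum_range]
  calc _ ≤ ∑ t ∈ Finset.range T, (η * (1 + regretFactor γ ^ 2) +
          (∫ ω, playedBonus γ A t ω ^ 2 ∂μ) / (2 * η) + 4 * N * (((t : ℝ) + 1) ^ 2)⁻¹) :=
        Finset.sum_le_sum fun t _ => (h.integral_optValue_sub_value_le hγ t).trans (by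
          gcongr
          exact h.integral_abs_seed_add_mul_playedBonus_le hγ.le _ hη t)
    _ = η * (1 + regretFactor γ ^ 2) * T +
          (∑ t ∈ Finset.range T, ∫ ω, playedBonus γ A t ω ^ 2 ∂μ) / (2 * η) +
          4 * N * ∑ t ∈ Finset.range T, (((t : ℝ) + 1) ^ 2)⁻¹ := by
        rw [Finset.sum_add_distrib, Finset.sum_add_distrib, Finset.sum_div, Finset.mul_sum,
          Finset.sum_const, Finset.card_range, nsmul_eq_mul, mul_comm (T : ℝ)]
    _ ≤ η * (1 + regretFactor γ ^ 2) * T +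
          I.maxCard * (γ * Real.log T) * (N * (1 + Real.log T)) / (2 * η) + 4 * N * 2 := by
        gcongr
        exacts [h.sum_integral_sq_playedBonus_le hγ.le T, sum_range_inv_sq_le T]
    _ = _ := by ring

theorem regret_le_maxCard_mul (T : ℕ) : regret I μ Θ A T ≤ I.maxCard * T := by
  have := h.isProbabilityMeasure
  rw [regret_eq_sum_range]
  refine (Finset.sum_le_card_nsmul _ _ (I.maxCard : ℝ) fun t _ => ?_).trans
    (by simp [mul_comm])
  refine (integral_mono_of_nonneg (.of_forall fun ω =>
    sub_nonneg.2 (I.value_le_optValue (h.play_mem t ω))) (integrable_const (I.maxCard : ℝ))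
    (.of_forall fun ω => ?_)).trans (by simp)
  exact I.optValue_sub_value_le_maxCard (h.avail_nonempty t ω) (h.avail_subset t ω) _

theorem regret_le_sqrt_of_maxCard_mul_le {T : ℕ} (hT : (I.maxCard : ℝ) * T ≤ N) :
    regret I μ Θ A T ≤ Real.sqrt (I.maxCard * N * T) :=
  (h.regret_le_maxCard_mul T).trans <| Real.le_sqrt_of_sq_le <| by
    calc (I.maxCard * T : ℝ) ^ 2 = I.maxCard * T * (I.maxCard * T) := sq _
      _ ≤ I.maxCard * T * N := by gcongr
      _ = I.maxCard * N * T := by ring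

theorem regret_le (hγ : 0 < γ) {T : ℕ} (hT : 2 ≤ T) :
    regret I μ Θ A T ≤ (1 + regretFactor γ ^ 2 + 3 / 2 * γ + 16) *
      (Real.log T * Real.sqrt (I.maxCard * N * T)) := by
  have hlog : 1 / 2 ≤ Real.log T := by
    linarith [Real.log_two_gt_d9, Real.log_le_log two_pos (by exact_mod_cast hT : (2 : ℝ) ≤ T)]
  have hTpos : (0 : ℝ) < T := by positivity
  set Q := Real.sqrt (I.maxCard * N * T)
  have hQ : Q ^ 2 = I.maxCard * N * T := Real.sq_sqrt (by positivity)
  rcases le_or_gt ((I.maxCard : ℝ) * T) N with hsmall | hlarge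
  · calc _ ≤ Q := h.regret_le_sqrt_of_maxCard_mul_le hsmall
      _ ≤ 16 * (Real.log T * Q) := by nlinarith [Real.sqrt_nonneg (I.maxCard * N * T : ℝ)]
      _ ≤ _ := by gcongr; linarith [sq_nonneg (regretFactor γ)]
  · have hN : (0 : ℝ) < N := by
      rcases N.eq_zero_or_pos with rfl | hN
      · have := I.maxCard_le
        simp_all
      · exact_mod_cast hN
    have hNQ : N ≤ Q := Real.le_sqrt_of_sq_le (by nlinarith)
    have hQpos : 0 < Q := hN.trans_le hNQ
    calc _ ≤ Real.log T * Q / T * (1 + regretFactor γ ^ 2) * T +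
            I.maxCard * (γ * Real.log T) * (N * (1 + Real.log T)) /
              (2 * (Real.log T * Q / T)) + 8 * N :=
          h.regret_le_of_pos hγ (by positivity) T
      _ = (1 + regretFactor γ ^ 2) * (Real.log T * Q) + γ / 2 * ((1 + Real.log T) * Q) +
            8 * N := by
          have : I.maxCard * (γ * Real.log T) * (N * (1 + Real.log T)) /
              (2 * (Real.log T * Q / T)) = γ / 2 * ((1 + Real.log T) * Q) := by
            rw [div_eq_iff (by positivity)]
            field_simp
            linear_combination (-1 : ℝ) * hQ
          rw [this]
          field_simp
      _ ≤ (1 + regretFactor γ ^ 2) * (Real.log T * Q) + γ / 2 * (3 * Real.log T * Q) +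
            8 * (2 * Real.log T * Q) := by
          gcongr
          · linarith
          · nlinarith
      _ = _ := by ring

end IsCLSGRun

/-! ### Comparing the indices of two arms -/

section Exchange

variable {α : Type*}

theorem subset_or_disjoint_of_maximal_sum {M : Type*} [AddCommMonoid M] [LinearOrder M]
    [IsOrderedCancelAddMonoid M] {f : α → M} {A H L : Finset α}
    (hmax : ∀ B : Finset α, B.card = A.card → ∑ a ∈ B, f a ≤ ∑ a ∈ A, f a)
    (hHL : ∀ g ∈ H, ∀ b ∈ L, f g < f b) : L ⊆ A ∨ Disjoint A H := by
  classical
  refine or_iff_not_imp_right.2 fun hAH b hb => by_contra fun hbA => ?_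
  obtain ⟨g, hgA, hgH⟩ := Finset.not_disjoint_iff.1 hAH
  have hbg : b ∉ A.erase g := fun h => hbA (Finset.mem_of_mem_erase h)
  have hexchange := hmax (insert b (A.erase g)) (by
    rw [Finset.card_insert_of_notMem hbg, Finset.card_erase_add_one hgA])
  rw [Finset.sum_insert hbg, ← Finset.add_sum_erase A f hgA] at hexchange
  exact (hHL g hgH b hb).not_ge (le_of_add_le_add_right hexchange)

theorem mul_card_filter_le_of_mul_sum_le {S : Finset α} {f : α → ℕ} {c j k : ℕ} (hc : 0 < c)
    (hsum : j * ∑ a ∈ S, f a ≤ k * c) : j * (S.filter (c ≤ f ·)).card ≤ k := by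
  refine Nat.le_of_mul_le_mul_right ?_ hc
  calc j * (S.filter (c ≤ f ·)).card * c = j * ∑ _a ∈ S.filter (c ≤ f ·), c := by
        rw [Finset.sum_const, smul_eq_mul, mul_assoc]
    _ ≤ j * ∑ a ∈ S, f a := Nat.mul_le_mul_left _
        ((Finset.sum_le_sum fun a ha => (Finset.mem_filter.1 ha).2).trans
          (Finset.sum_le_sum_of_subset (Finset.filter_subset _ _)))
    _ ≤ k * c := hsum

/-- At most half of `G` has few plays and at most half of `Gᶜ` has many, so an exchange argument
forces a maximizer either to contain the rest of `Gᶜ` or to miss the rest of `G`. -/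
theorem le_two_mul_card_sdiff_of_maximal_sum [Fintype α] [DecidableEq α] {f : α → ℝ} {n : α → ℕ}
    {m u : ℕ} {A G : Finset α} (hu : 0 < u) (hA : A.card = m) (hG : G.card = m) (hGc : Gᶜ.card = m)
    (hmax : ∀ B : Finset α, B.card = A.card → ∑ a ∈ B, f a ≤ ∑ a ∈ A, f a)
    (hn : ∀ a, n a ≤ u) (hsum : ∑ a, n a = m * u) (hrare : 8 * ∑ a ∈ Gᶜ, n a ≤ m * u)
    (hf : ∀ g ∈ G, ∀ b ∉ G, u < 2 * n g → 4 * n b < u → f g < f b) :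
    m ≤ 2 * (A \ G).card := by
  have hdeficit : ∑ g ∈ G, (u - n g) = ∑ b ∈ Gᶜ, n b := by
    have hfull : ∑ g ∈ G, (u - n g) + ∑ g ∈ G, n g = m * u := by
      rw [← Finset.sum_add_distrib, Finset.sum_congr rfl fun g _ => Nat.sub_add_cancel (hn g),
        Finset.sum_const, hG, smul_eq_mul]
    have := Finset.sum_add_sum_compl G n
    omega
  have hoften : 2 * (Gᶜ.filter (u ≤ 4 * n ·)).card ≤ m :=
    mul_card_filter_le_of_mul_sum_le (f := fun a => 4 * n a) (j := 2) hu
      (by rw [← Finset.mul_sum]; omega)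
  have hseldom : 2 * (G.filter (fun g => u ≤ 2 * (u - n g))).card ≤ m :=
    mul_card_filter_le_of_mul_sum_le (f := fun a => 2 * (u - n a)) (j := 2) hu
      (by rw [← Finset.mul_sum]; omega)
  rcases subset_or_disjoint_of_maximal_sum (H := G.filter (fun g => ¬ u ≤ 2 * (u - n g)))
      (L := Gᶜ.filter (¬ u ≤ 4 * n ·)) hmax (by
        simp only [Finset.mem_filter, Finset.mem_compl, not_le]
        exact fun g hg b hb => hf g hg.1 b hb.1 (by omega) hb.2) with hsub | hdisj
  · have hle : (Gᶜ.filter (¬ u ≤ 4 * n ·)).card ≤ (A \ G).card :=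
      Finset.card_le_card fun b hb => Finset.mem_sdiff.2
        ⟨hsub hb, Finset.mem_compl.1 (Finset.mem_of_mem_filter b hb)⟩
    have := Finset.card_filter_add_card_filter_not (s := Gᶜ) (u ≤ 4 * n ·)
    omega
  · have hle : (A ∩ G).card ≤ (G.filter (fun g => u ≤ 2 * (u - n g))).card :=
      Finset.card_le_card fun g hg => by
        obtain ⟨hgA, hgG⟩ := Finset.mem_inter.1 hg
        refine Finset.mem_filter.2 ⟨hgG, by_contra fun hlt => ?_⟩
        exact Finset.disjoint_left.1 hdisj hgA (Finset.mem_filter.2 ⟨hgG, hlt⟩)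
    have := Finset.card_inter_add_card_sdiff A G
    omega

end Exchange

section Index

variable {N : ℕ} {γ : ℝ} {A : ℕ → Finset (Fin N)} {X : ℕ → Fin N → ℝ} {a b : Fin N} {t T : ℕ}

theorem log_le_two_mul_log_succ (hTt : T ≤ 2 * t) :
    Real.log T ≤ 2 * Real.log ((t + 1 : ℕ) : ℝ) := by
  rcases T.eq_zero_or_pos with rfl | hT
  · simpa using Real.log_natCast_nonneg (t + 1)
  · calc Real.log T ≤ Real.log (((t + 1 : ℕ) : ℝ) ^ 2) :=
          Real.log_le_log (by positivity) (by exact_mod_cast (by nlinarith : T ≤ (t + 1) ^ 2))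
      _ = _ := by rw [Real.log_pow, Nat.cast_ofNat]

theorem bonus_le_mul_bonus (hγ : 0 ≤ γ) {c : ℝ} (hc : 0 ≤ c)
    (hn : (pulls A b t : ℝ) + 1 ≤ c ^ 2 * (pulls A a t + 1)) :
    bonus γ A a t ≤ c * bonus γ A b t := by
  have := Real.log_natCast_nonneg t
  refine Real.sqrt_le_iff.2 ⟨by have := bonus_nonneg γ A b t; positivity, ?_⟩
  rw [mul_pow, bonus, Real.sq_sqrt (by positivity), ← mul_div_assoc,
    div_le_div_iff₀ (by positivity) (by positivity)]
  calc _ ≤ γ * Real.log t * (c ^ 2 * (pulls A a t + 1)) := by gcongr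
    _ = _ := by ring

theorem sqrt_log_div_le_two_mul_bonus (hγ : 0 ≤ γ) (hTt : T ≤ 2 * t)
    (hn : pulls A a (t + 1) + 1 ≤ T) :
    Real.sqrt (γ * Real.log T / T) ≤ 2 * bonus γ A a (t + 1) := by
  have hlog := log_le_two_mul_log_succ hTt
  have hlog0 := Real.log_natCast_nonneg (t + 1)
  have hn : (pulls A a (t + 1) : ℝ) + 1 ≤ T := by exact_mod_cast hn
  refine Real.sqrt_le_iff.2 ⟨by have := bonus_nonneg γ A a (t + 1); positivity, ?_⟩
  rw [mul_pow, bonus, Real.sq_sqrt (by positivity), ← mul_div_assoc]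
  refine div_le_div₀ (by positivity) ?_ (by positivity) hn
  nlinarith [mul_nonneg hγ hlog0, mul_le_mul_of_nonneg_left hlog hγ]

theorem perturbed_lt_perturbed (hγ : 0 ≤ γ) {Δ w : ℝ} (hT : 28 ≤ T) (htT : t < T)
    (hTt : T ≤ 2 * t) (hΔ : 0 < Δ) (hΔT : 8 * Δ ≤ Real.sqrt (γ * Real.log T / T)) (hw : 1 < w)
    (ha : t < 2 * pulls A a (t + 1)) (hb : 4 * pulls A b (t + 1) < t)
    (hXa : empMean A X a (t + 1) ≤ Δ) (hXb : 0 ≤ empMean A X b (t + 1)) :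
    perturbed γ A X w a (t + 1) < perturbed γ A X w b (t + 1) := by
  have hbonus : bonus γ A a (t + 1) ≤ 3 / 4 * bonus γ A b (t + 1) := by
    refine bonus_le_mul_bonus hγ (by norm_num) ?_
    have ha : (t : ℝ) < 2 * pulls A a (t + 1) := by exact_mod_cast ha
    have hb : 4 * (pulls A b (t + 1) : ℝ) < t := by exact_mod_cast hb
    have ht : (14 : ℝ) ≤ t := by exact_mod_cast (by omega : 14 ≤ t)
    linarith
  have hgap : 4 * Δ ≤ bonus γ A b (t + 1) := by
    linarith [sqrt_log_div_le_two_mul_bonus hγ hTt (by omega : pulls A b (t + 1) + 1 ≤ T)]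
  calc empMean A X a (t + 1) + w * bonus γ A a (t + 1)
      ≤ Δ + w * (3 / 4 * bonus γ A b (t + 1)) := by gcongr
    _ < 0 + w * bonus γ A b (t + 1) := by nlinarith
    _ ≤ empMean A X b (t + 1) + w * bonus γ A b (t + 1) := by gcongr

end Index

/-! ### A top-`m` instance with two reward levels -/

/-- The half of the base arms that has a positive mean in `twoLevelInstance`. -/
def goodArms (m : ℕ) : Finset (Fin (2 * m)) := Finset.univ.filter (fun a => a.val < m)

theorem card_goodArms (m : ℕ) : (goodArms m).card = m := by
  rw [goodArms, Fin.card_filter_val_lt]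
  omega

theorem card_compl_goodArms (m : ℕ) : (goodArms m)ᶜ.card = m := by
  rw [Finset.card_compl, card_goodArms, Fintype.card_fin]
  omega

/-- The top-`m` instance on `2 * m` base arms with deterministic rewards, `Δ` for the good arms and
`0` for the others; it is the hard instance of the lower bound. -/
noncomputable def twoLevelInstance (m : ℕ) (Δ : ℝ) (hΔ : Δ ∈ Set.Icc (0 : ℝ) 1) :
    SemiBandit (2 * m) where
  feasible := Finset.univ.powersetCard m
  law a := Measure.dirac (if a ∈ goodArms m then Δ else 0)
  isProb _ := inferInstance
  support a := by
    refine (ae_dirac_iff measurableSet_Icc).2 ?_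
    split_ifs
    · exact hΔ
    · simp

section TwoLevel

variable {m : ℕ} {Δ : ℝ} {hΔ : Δ ∈ Set.Icc (0 : ℝ) 1}

theorem value_twoLevelInstance (B : Finset (Fin (2 * m))) :
    (twoLevelInstance m Δ hΔ).value B = Δ * (B ∩ goodArms m).card := by
  simp only [SemiBandit.value, SemiBandit.mean, twoLevelInstance, integral_dirac]
  rw [← Finset.sum_filter, Finset.filter_mem_eq_inter, Finset.sum_const, nsmul_eq_mul, mul_comm]

variable (m hΔ) in
theorem goodArms_mem_feasible_twoLevelInstance :
    goodArms m ∈ (twoLevelInstance m Δ hΔ).feasible :=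
  Finset.mem_powersetCard.2 ⟨Finset.subset_univ _, card_goodArms m⟩

theorem optValue_twoLevelInstance :
    (twoLevelInstance m Δ hΔ).optValue (twoLevelInstance m Δ hΔ).feasible = Δ * m := by
  refine le_antisymm ?_ ?_
  · obtain ⟨B, -, hopt⟩ := (twoLevelInstance m Δ hΔ).exists_optValue_eq
      ⟨_, goodArms_mem_feasible_twoLevelInstance m hΔ⟩
    rw [hopt, value_twoLevelInstance]
    gcongr
    · exact hΔ.1
    · exact (Finset.card_le_card Finset.inter_subset_right).trans_eq (card_goodArms m)
  · have := (twoLevelInstance m Δ hΔ).value_le_optValue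
      (goodArms_mem_feasible_twoLevelInstance m hΔ)
    rwa [value_twoLevelInstance, Finset.inter_self, card_goodArms] at this

theorem optValue_sub_value_twoLevelInstance {B : Finset (Fin (2 * m))} (hB : B.card = m) :
    (twoLevelInstance m Δ hΔ).optValue (twoLevelInstance m Δ hΔ).feasible -
      (twoLevelInstance m Δ hΔ).value B = Δ * (B \ goodArms m).card := by
  have hsplit : (m : ℝ) = (B ∩ goodArms m).card + (B \ goodArms m).card := by
    exact_mod_cast hB ▸ (Finset.card_inter_add_card_sdiff B (goodArms m)).symm
  rw [optValue_twoLevelInstance, value_twoLevelInstance, hsplit]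
  ring

end TwoLevel

/-- The number of plays of base arms outside `goodArms m` in the rounds `1, …, t`. -/
def badPulls {m : ℕ} {Ω : Type*} (A : ℕ → Ω → Finset (Fin (2 * m))) (t : ℕ) (ω : Ω) : ℕ :=
  ∑ a ∈ (goodArms m)ᶜ, pulls (A · ω) a (t + 1)

theorem badPulls_eq_sum {m : ℕ} {Ω : Type*} (A : ℕ → Ω → Finset (Fin (2 * m))) (t : ℕ) (ω : Ω) :
    badPulls A t ω = ∑ s ∈ Finset.range t, (A (s + 1) ω \ goodArms m).card := by
  simp only [badPulls, sum_pulls_succ, Finset.sdiff_eq_inter_compl]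

theorem badPulls_mono {m : ℕ} {Ω : Type*} (A : ℕ → Ω → Finset (Fin (2 * m))) (ω : Ω) :
    Monotone (badPulls A · ω) := fun s t hst => by
  simp only [badPulls_eq_sum]
  exact Finset.sum_le_sum_of_subset (Finset.range_mono hst)

/-! ### Lower bound -/

theorem exists_sqrt_log_div_div_mem_Icc (γ : ℝ) {c : ℝ} (hc : 0 < c) :
    ∃ T₀ : ℕ, ∀ T : ℕ, T₀ ≤ T → Real.sqrt (γ * Real.log T / T) / c ∈ Set.Icc (0 : ℝ) 1 := by
  have hlim : Filter.Tendsto (fun T : ℕ => γ * Real.log T / T) Filter.atTop (nhds 0) := by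
    simpa [mul_div_assoc] using ((Real.tendsto_pow_log_div_mul_add_atTop 1 0 1 one_ne_zero).comp
      tendsto_natCast_atTop_atTop).const_mul γ
  refine Filter.eventually_atTop.1 ((hlim.eventually_le_const (pow_pos hc 2)).mono fun T hT => ?_)
  exact ⟨by positivity, (div_le_one hc).2 (Real.sqrt_le_iff.2 ⟨hc.le, hT⟩)⟩

namespace IsCLSGRun

section Instance

variable {N : ℕ} {I : SemiBandit N} {γ : ℝ} {Ω : Type*} [mΩ : MeasurableSpace Ω]
  {μ : Measure Ω} {𝓕 : Filtration ℕ mΩ} {Θ : ℕ → Ω → Finset (Finset (Fin N))}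
  {w : ℕ → Ω → ℝ} {A : ℕ → Ω → Finset (Fin N)} {X : ℕ → Fin N → Ω → ℝ}

theorem measurable_card_sdiff (h : IsCLSGRun I γ μ 𝓕 Θ w A X) (G : Finset (Fin N)) (t : ℕ) :
    Measurable[𝓕 (t + 1)] fun ω => (A (t + 1) ω \ G).card :=
  measurable_apply_index (g := fun B _ => (B \ G).card) (h.play_meas t) fun _ => measurable_const

theorem integrable_card_sdiff (h : IsCLSGRun I γ μ 𝓕 Θ w A X) (G : Finset (Fin N)) (t : ℕ) :
    Integrable (fun ω => ((A (t + 1) ω \ G).card : ℝ)) μ := by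
  have := h.isProbabilityMeasure
  have hm : Measurable fun ω => ((A (t + 1) ω \ G).card : ℝ) :=
    measurable_from_top.comp ((h.measurable_card_sdiff G t).mono (𝓕.le _) le_rfl)
  refine Integrable.of_bound hm.aestronglyMeasurable N (.of_forall fun ω => ?_)
  rw [Real.norm_natCast, Nat.cast_le]
  exact (Finset.card_le_univ _).trans_eq (Fintype.card_fin N)

end Instance

variable {m : ℕ} {Δ : ℝ} {hΔ : Δ ∈ Set.Icc (0 : ℝ) 1} {γ : ℝ} {Ω : Type*}
  [mΩ : MeasurableSpace Ω] {μ : Measure Ω} {𝓕 : Filtration ℕ mΩ} {w : ℕ → Ω → ℝ}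
  {A : ℕ → Ω → Finset (Fin (2 * m))} {X : ℕ → Fin (2 * m) → Ω → ℝ} {t T : ℕ}
  (h : IsCLSGRun (twoLevelInstance m Δ hΔ) γ μ 𝓕
    (fun _ _ => (twoLevelInstance m Δ hΔ).feasible) w A X)

include h

theorem card_play_twoLevelInstance (t : ℕ) (ω : Ω) : (A (t + 1) ω).card = m :=
  (Finset.mem_powersetCard.1 (h.play_mem t ω)).2

theorem measurable_badPulls (t : ℕ) : Measurable[𝓕 t] (badPulls A t) := by
  have hsum : badPulls A t = fun ω => ∑ s ∈ Finset.range t, (A (s + 1) ω \ goodArms m).card :=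
    funext (badPulls_eq_sum A t)
  rw [hsum]
  exact Finset.measurable_fun_sum _ fun s hs =>
    (h.measurable_card_sdiff _ s).mono (𝓕.mono (Finset.mem_range.1 hs)) le_rfl

theorem measurableSet_mul_badPulls_le (k c t : ℕ) :
    MeasurableSet[𝓕 t] {ω | k * badPulls A t ω ≤ c} :=
  h.measurable_badPulls t (MeasurableSet.of_discrete (s := {n | k * n ≤ c}))

theorem integral_badPulls (T : ℕ) : ∫ ω, (badPulls A T ω : ℝ) ∂μ =
    ∑ t ∈ Finset.range T, ∫ ω, ((A (t + 1) ω \ goodArms m).card : ℝ) ∂μ := by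
  simp only [badPulls_eq_sum, Nat.cast_sum]
  exact integral_finsetSum _ fun t _ => h.integrable_card_sdiff _ t

theorem regret_twoLevelInstance (T : ℕ) :
    regret (twoLevelInstance m Δ hΔ) μ (fun _ _ => (twoLevelInstance m Δ hΔ).feasible) A T =
      Δ * ∫ ω, (badPulls A T ω : ℝ) ∂μ := by
  simp only [regret_eq_sum_range, h.integral_badPulls, Finset.mul_sum, ← integral_const_mul,
    optValue_sub_value_twoLevelInstance (h.card_play_twoLevelInstance _ _)]

theorem ae_reward_eq : ∀ᵐ ω ∂μ, ∀ a t, X (t + 1) a ω = if a ∈ goodArms m then Δ else 0 :=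
  ae_all_iff.2 fun a => ae_all_iff.2 fun t => (h.hasLaw_reward t a).ae_eq_of_dirac

theorem le_two_mul_card_sdiff_goodArms (hγ : 0 ≤ γ) (hΔ₀ : 0 < Δ)
    (hΔT : 8 * Δ ≤ Real.sqrt (γ * Real.log T / T)) (hT : 28 ≤ T) (htT : t < T)
    (hTt : T ≤ 2 * t) : ∀ᵐ ω ∂μ, 1 < w (t + 1) ω → 8 * badPulls A t ω ≤ m * t →
      m ≤ 2 * (A (t + 1) ω \ goodArms m).card := by
  filter_upwards [h.ae_reward_eq, h.ae_reward_mem_Icc] with ω hX hXmem hw hbad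
  have hplays : ∑ a, pulls (A · ω) a (t + 1) = m * t := by
    simp only [sum_pulls_succ, Finset.inter_univ, h.card_play_twoLevelInstance, Finset.sum_const,
      Finset.card_range, smul_eq_mul, mul_comm]
  refine le_two_mul_card_sdiff_of_maximal_sum (n := fun a => pulls (A · ω) a (t + 1)) (by omega)
    (h.card_play_twoLevelInstance t ω) (card_goodArms m) (card_compl_goodArms m)
    (fun B hB => h.play_max t ω B (Finset.mem_powersetCard.2
      ⟨Finset.subset_univ B, hB.trans (h.card_play_twoLevelInstance t ω)⟩))
    (fun a => pulls_succ_le _ a t) hplays hbad fun g hg b _ hgn hbn => ?_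
  have hmean : empMean (A · ω) (X · · ω) g (t + 1) = Δ :=
    empMean_eq_of_forall_eq (fun s => (hX g s).trans (if_pos hg)) (by omega)
  exact perturbed_lt_perturbed hγ hT htT hTt hΔ₀ hΔT hw hgn hbn hmean.le
    (empMean_mem_Icc (hXmem b) _).1

theorem integral_card_sdiff_goodArms_ge (hγ : 0 ≤ γ) (hΔ₀ : 0 < Δ)
    (hΔT : 8 * Δ ≤ Real.sqrt (γ * Real.log T / T)) (hT : 28 ≤ T) (htT : t < T)
    (hTt : T ≤ 2 * t) :
    m / 2 * ((gaussianReal 0 1).real (Set.Ioi 1) * μ.real {ω | 8 * badPulls A t ω ≤ m * t}) ≤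
      ∫ ω, ((A (t + 1) ω \ goodArms m).card : ℝ) ∂μ := by
  set E := {ω | 8 * badPulls A t ω ≤ m * t}
  have hE : MeasurableSet[𝓕 t] E := h.measurableSet_mul_badPulls_le 8 (m * t) t
  have hindicator : Measurable[𝓕 t] (E.indicator (1 : Ω → ℝ)) :=
    (@measurable_const ℝ Ω _ (𝓕 t) 1).indicator hE
  rw [← integral_indicator_one measurableSet_Ioi, ← integral_indicator_one (𝓕.le t _ hE),
    ← h.integral_comp_seed_mul t (measurable_one.indicator measurableSet_Ioi)
      hindicator, ← integral_const_mul]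
  refine integral_mono_of_nonneg (.of_forall fun ω => ?_) (h.integrable_card_sdiff _ t) ?_
  · exact mul_nonneg (by positivity) (mul_nonneg
      (Set.indicator_nonneg (fun _ _ => zero_le_one) _)
      (Set.indicator_nonneg (fun _ _ => zero_le_one) _))
  · filter_upwards [h.le_two_mul_card_sdiff_goodArms hγ hΔ₀ hΔT hT htT hTt] with ω hω
    by_cases hrare : 1 < w (t + 1) ω ∧ ω ∈ E
    · have : (m : ℝ) ≤ 2 * (A (t + 1) ω \ goodArms m).card := by
        exact_mod_cast hω hrare.1 hrare.2
      rw [Set.indicator_of_mem (Set.mem_Ioi.2 hrare.1), Set.indicator_of_mem hrare.2]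
      simp only [Pi.one_apply, mul_one]
      linarith
    · rw [not_and_or] at hrare
      rcases hrare with hw | hE <;> simp [*]

theorem integral_badPulls_ge_mul_measureReal (hγ : 0 ≤ γ) (hΔ₀ : 0 < Δ)
    (hΔT : 8 * Δ ≤ Real.sqrt (γ * Real.log T / T)) (hT : 28 ≤ T) :
    (gaussianReal 0 1).real (Set.Ioi 1) / 8 * (m * T) *
        μ.real {ω | 16 * badPulls A T ω ≤ m * T} ≤ ∫ ω, (badPulls A T ω : ℝ) ∂μ := by
  have := h.isProbabilityMeasure
  set p := (gaussianReal 0 1).real (Set.Ioi 1)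
  set E := {ω | 16 * badPulls A T ω ≤ m * T}
  have hround : ∀ t ∈ Finset.Ico ((T + 1) / 2) T,
      m / 2 * (p * μ.real E) ≤ ∫ ω, ((A (t + 1) ω \ goodArms m).card : ℝ) ∂μ := by
    intro t ht
    obtain ⟨hTt, htT⟩ := Finset.mem_Ico.1 ht
    have hTt : T ≤ 2 * t := by omega
    refine le_trans ?_ (h.integral_card_sdiff_goodArms_ge hγ hΔ₀ hΔT hT htT hTt)
    have hsub : E ⊆ {ω | 8 * badPulls A t ω ≤ m * t} := by
      intro ω (hω : 16 * badPulls A T ω ≤ m * T)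
      have hle := badPulls_mono A ω htT.le
      have hmul := Nat.mul_le_mul_left m hTt
      simp only [Set.mem_ofPred_eq]
      linarith
    gcongr
    exact measure_ne_top _ _
  have hcard : (T : ℝ) / 4 ≤ (Finset.Ico ((T + 1) / 2) T).card := by
    rw [Nat.card_Ico, div_le_iff₀ (by norm_num)]
    exact_mod_cast (by omega : T ≤ (T - (T + 1) / 2) * 4)
  calc p / 8 * (m * T) * μ.real E = T / 4 * (m / 2 * (p * μ.real E)) := by ring
    _ ≤ (Finset.Ico ((T + 1) / 2) T).card * (m / 2 * (p * μ.real E)) := by gcongr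
    _ ≤ ∑ t ∈ Finset.Ico ((T + 1) / 2) T, ∫ ω, ((A (t + 1) ω \ goodArms m).card : ℝ) ∂μ := by
        rw [← nsmul_eq_mul]
        exact Finset.card_nsmul_le_sum _ _ _ hround
    _ ≤ ∑ t ∈ Finset.range T, ∫ ω, ((A (t + 1) ω \ goodArms m).card : ℝ) ∂μ :=
        Finset.sum_le_sum_of_subset_of_nonneg
          (fun t ht => Finset.mem_range.2 (Finset.mem_Ico.1 ht).2)
          fun _ _ _ => integral_nonneg fun _ => Nat.cast_nonneg _
    _ = _ := (h.integral_badPulls T).symm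

theorem integral_badPulls_ge_mul_one_sub_measureReal (T : ℕ) :
    m * T / 16 * (1 - μ.real {ω | 16 * badPulls A T ω ≤ m * T}) ≤
      ∫ ω, (badPulls A T ω : ℝ) ∂μ := by
  have := h.isProbabilityMeasure
  have hint : Integrable (fun ω => (badPulls A T ω : ℝ)) μ := by
    simp only [badPulls_eq_sum, Nat.cast_sum]
    exact integrable_finsetSum _ fun t _ => h.integrable_card_sdiff _ t
  rw [← probReal_compl_eq_one_sub (𝓕.le T _ (h.measurableSet_mul_badPulls_le 16 (m * T) T))]
  refine le_trans ?_ (mul_meas_ge_le_integral_of_nonneg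
    (.of_forall fun _ => Nat.cast_nonneg _) hint (m * T / 16))
  gcongr
  · exact measure_ne_top _ _
  · intro ω (hω : ¬ 16 * badPulls A T ω ≤ m * T)
    have hlt : (m : ℝ) * T < 16 * badPulls A T ω := by exact_mod_cast not_le.1 hω
    simp only [Set.mem_ofPred_eq]
    linarith

theorem integral_badPulls_ge (hγ : 0 ≤ γ) (hΔ₀ : 0 < Δ)
    (hΔT : 8 * Δ ≤ Real.sqrt (γ * Real.log T / T)) (hT : 28 ≤ T) :
    (gaussianReal 0 1).real (Set.Ioi 1) / 32 * (m * T) ≤ ∫ ω, (badPulls A T ω : ℝ) ∂μ := by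
  have hp₀ : 0 ≤ (gaussianReal 0 1).real (Set.Ioi 1) := measureReal_nonneg
  have hp₁ : (gaussianReal 0 1).real (Set.Ioi 1) ≤ 1 := measureReal_le_one
  have hJ : 0 ≤ ∫ ω, (badPulls A T ω : ℝ) ∂μ := integral_nonneg fun _ => Nat.cast_nonneg _
  have hrare := h.integral_badPulls_ge_mul_measureReal hγ hΔ₀ hΔT hT
  have hfrequent := mul_le_mul_of_nonneg_left
    (h.integral_badPulls_ge_mul_one_sub_measureReal T) hp₀
  have hle := mul_le_of_le_one_left hJ hp₁
  linarith

theorem regret_ge (hγ : 0 < γ) (hΔT : Δ = Real.sqrt (γ * Real.log T / T) / 8) (hT : 28 ≤ T) :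
    (gaussianReal 0 1).real (Set.Ioi 1) * Real.sqrt γ / 512 *
        Real.sqrt (m * (2 * m : ℕ) * T * Real.log T) ≤
      regret (twoLevelInstance m Δ hΔ) μ (fun _ _ => (twoLevelInstance m Δ hΔ).feasible) A T := by
  have hT₀ : (0 : ℝ) < T := by exact_mod_cast (by omega : 0 < T)
  have hlog : 0 < Real.log T := Real.log_pos (by exact_mod_cast (by omega : 1 < T))
  have hΔ₀ : 0 < Δ := by rw [hΔT]; positivity
  have hsqrt : Real.sqrt γ * Real.sqrt (m * (2 * m : ℕ) * T * Real.log T) ≤ 16 * Δ * (m * T) := by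
    rw [← Real.sqrt_mul hγ.le, hΔT]
    refine Real.sqrt_le_iff.2 ⟨by positivity, ?_⟩
    rw [mul_pow, mul_pow, div_pow, Real.sq_sqrt (by positivity)]
    have : (0 : ℝ) ≤ γ * m ^ 2 * T * Real.log T := by positivity
    field_simp
    push_cast
    nlinarith
  rw [h.regret_twoLevelInstance]
  calc _ = (gaussianReal 0 1).real (Set.Ioi 1) / 512 *
        (Real.sqrt γ * Real.sqrt (m * (2 * m : ℕ) * T * Real.log T)) := by ring
    _ ≤ (gaussianReal 0 1).real (Set.Ioi 1) / 512 * (16 * Δ * (m * T)) := by gcongr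
    _ = Δ * ((gaussianReal 0 1).real (Set.Ioi 1) / 32 * (m * T)) := by ring
    _ ≤ _ := mul_le_mul_of_nonneg_left (h.integral_badPulls_ge hγ.le hΔ₀ (by linarith) hT) hΔ₀.le

end IsCLSGRun

/-! ### Running CL-SG on an instance with deterministic rewards -/

theorem exists_measurable_argmax {Ω ι : Type*} [MeasurableSpace Ω] [Countable ι] {f : ι → Ω → ℝ}
    (hf : ∀ i, Measurable (f i)) {S : Finset ι} (hS : S.Nonempty) :
    ∃ g : Ω → ι, (∀ ω, g ω ∈ S ∧ ∀ i ∈ S, f i ω ≤ f (g ω) ω) ∧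
      ∀ i, MeasurableSet {ω | g ω = i} := by
  classical
  induction hS using Finset.Nonempty.cons_induction with
  | singleton j => exact ⟨fun _ => j, by simp, fun i => MeasurableSet.const (j = i)⟩
  | cons j S hj _ ih =>
    obtain ⟨g, hmax, hg⟩ := ih
    have hE : MeasurableSet {ω | f (g ω) ω ≤ f j ω} :=
      measurableSet_le (measurable_apply_index hg hf) (hf j)
    refine ⟨fun ω => if f (g ω) ω ≤ f j ω then j else g ω, fun ω => ?_, fun i => ?_⟩
    · have := hmax ω
      grind
    · have hsplit : {ω | (if f (g ω) ω ≤ f j ω then j else g ω) = i} =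
          {ω | f (g ω) ω ≤ f j ω}.ite {_ω | j = i} {ω | g ω = i} := by
        ext ω
        by_cases hle : f (g ω) ω ≤ f j ω <;> simp [Set.ite, hle]
      exact hsplit ▸ hE.ite (MeasurableSet.const _) (hg i)

section Greedy

variable {N : ℕ}

/-- The perturbed estimate of a base arm in round `t` as a function of the numbers of plays `n` and
of the seed `x`, for deterministic rewards `r`. -/
noncomputable def countIndex (γ : ℝ) (r : Fin N → ℝ) (t : ℕ) (n : Fin N → ℕ) (x : ℝ)
    (a : Fin N) : ℝ :=
  (if n a = 0 then 0 else r a) + x * Real.sqrt (γ * Real.log t / ((n a : ℝ) + 1))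

theorem measurable_sum_countIndex (γ : ℝ) (r : Fin N → ℝ) (t : ℕ) (n : Fin N → ℕ)
    (B : Finset (Fin N)) : Measurable fun x => ∑ a ∈ B, countIndex γ r t n x a :=
  Finset.measurable_fun_sum _ fun _ _ => measurable_const.add (measurable_id.mul_const _)

variable {S : Finset (Finset (Fin N))} (hS : S.Nonempty) (γ : ℝ) (r : Fin N → ℝ)

/-- The super arm that CL-SG plays, with `S` available and a measurable breaking of ties, as a
function of the seed. -/
noncomputable def greedyChoice (t : ℕ) (n : Fin N → ℕ) : ℝ → Finset (Fin N) :=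
  (exists_measurable_argmax (measurable_sum_countIndex γ r t n) hS).choose

theorem greedyChoice_mem (t : ℕ) (n : Fin N → ℕ) (x : ℝ) : greedyChoice hS γ r t n x ∈ S :=
  ((exists_measurable_argmax (measurable_sum_countIndex γ r t n) hS).choose_spec.1 x).1

theorem sum_countIndex_le_greedyChoice (t : ℕ) (n : Fin N → ℕ) (x : ℝ) {B : Finset (Fin N)}
    (hB : B ∈ S) : ∑ a ∈ B, countIndex γ r t n x a ≤
      ∑ a ∈ greedyChoice hS γ r t n x, countIndex γ r t n x a :=
  ((exists_measurable_argmax (measurable_sum_countIndex γ r t n) hS).choose_spec.1 x).2 B hB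

theorem measurableSet_greedyChoice_eq (t : ℕ) (n : Fin N → ℕ) (B : Finset (Fin N)) :
    MeasurableSet {x | greedyChoice hS γ r t n x = B} :=
  (exists_measurable_argmax (measurable_sum_countIndex γ r t n) hS).choose_spec.2 B

/-- The numbers of plays after `t` rounds when the seeds are `x 1, x 2, …`. -/
noncomputable def greedyCounts (x : ℕ → ℝ) : ℕ → Fin N → ℕ
  | 0 => 0
  | t + 1 => fun a => greedyCounts x t a +
      if a ∈ greedyChoice hS γ r (t + 1) (greedyCounts x t) (x (t + 1)) then 1 else 0

/-- The super arm that is played in round `t` when the seeds are `x 1, x 2, …`; there is no round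
`0`, and the value there is arbitrary. -/
noncomputable def greedyPlay (t : ℕ) (x : ℕ → ℝ) : Finset (Fin N) :=
  greedyChoice hS γ r t (greedyCounts hS γ r x (t - 1)) (x t)

theorem pulls_greedyPlay (x : ℕ → ℝ) (a : Fin N) (t : ℕ) :
    pulls (greedyPlay hS γ r · x) a (t + 1) = greedyCounts hS γ r x t a := by
  induction t with
  | zero => exact pulls_one _ a
  | succ t ih =>
    rw [pulls_add_two, ih, greedyCounts]
    rfl

theorem perturbed_greedyPlay (x : ℕ → ℝ) (y : ℝ) (a : Fin N) (t : ℕ) :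
    perturbed γ (greedyPlay hS γ r · x) (fun _ b => r b) y a (t + 1) =
      countIndex γ r (t + 1) (greedyCounts hS γ r x t) y a := by
  have hmean : empMean (greedyPlay hS γ r · x) (fun _ b => r b) a (t + 1) =
      if greedyCounts hS γ r x t a = 0 then 0 else r a := by
    rw [← pulls_greedyPlay]
    split_ifs with h0
    · rw [empMean, h0, Nat.cast_zero, div_zero]
    · exact empMean_eq_of_forall_eq (fun _ => rfl) h0
  rw [perturbed, hmean, pulls_greedyPlay, countIndex]

/-- The filtration generated by the seeds. -/
def seedFiltration : Filtration ℕ (inferInstance : MeasurableSpace (ℕ → ℝ)) :=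
  Filtration.natural (fun t x => x t) fun t => (measurable_pi_apply t).stronglyMeasurable

theorem measurable_seedFiltration (t : ℕ) : Measurable[seedFiltration t] (fun x : ℕ → ℝ => x t) :=
  (Filtration.stronglyAdapted_natural (u := fun t (x : ℕ → ℝ) => x t)
    (fun t => (measurable_pi_apply t).stronglyMeasurable) t).measurable

theorem measurableSet_greedyPlay_of_greedyCounts {t : ℕ}
    (hc : ∀ n, MeasurableSet[seedFiltration t] {x | greedyCounts hS γ r x t = n})
    (B : Finset (Fin N)) :
    MeasurableSet[seedFiltration (t + 1)] {x | greedyPlay hS γ r (t + 1) x = B} :=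
  measurableSet_apply_index (p := fun n x => greedyChoice hS γ r (t + 1) n (x (t + 1)) = B)
    (fun n => seedFiltration.mono (Nat.le_succ t) _ (hc n)) fun n =>
      measurable_seedFiltration (t + 1) (measurableSet_greedyChoice_eq hS γ r (t + 1) n B)

theorem measurableSet_greedyCounts (t : ℕ) (n : Fin N → ℕ) :
    MeasurableSet[seedFiltration t] {x | greedyCounts hS γ r x t = n} := by
  induction t generalizing n with
  | zero => exact MeasurableSet.const (0 = n)
  | succ t ih =>
    exact measurableSet_apply_index
      (p := fun B x => (fun a => greedyCounts hS γ r x t a + if a ∈ B then 1 else 0) = n)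
      (measurableSet_greedyPlay_of_greedyCounts hS γ r ih) fun B =>
        measurableSet_of_index (fun k => seedFiltration.mono (Nat.le_succ t) _ (ih k))
          fun k => (fun a => k a + if a ∈ B then 1 else 0) = n

end Greedy

theorem isCLSGRun_greedyPlay {N : ℕ} (I : SemiBandit N) (hS : I.feasible.Nonempty) (γ : ℝ)
    (r : Fin N → ℝ) (hr : ∀ a, I.law a = Measure.dirac (r a)) :
    IsCLSGRun I γ (Measure.infinitePi fun _ : ℕ => gaussianReal 0 1) seedFiltration
      (fun _ _ => I.feasible) (fun t x => x t) (greedyPlay hS γ r) (fun _ a _ => r a) where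
  avail_meas _ _ := MeasurableSet.const _
  avail_subset _ _ := subset_rfl
  avail_nonempty _ _ := hS
  seed_meas t := measurable_seedFiltration (t + 1)
  seed_law t := Measure.infinitePi_map_eval (fun _ : ℕ => gaussianReal 0 1) (t + 1)
  seed_indep t := (iIndepFun_infinitePi (P := fun _ : ℕ => gaussianReal 0 1)
    (X := fun _ x => x) fun _ => measurable_id).indep_comap_natural_of_lt
      (fun t => (measurable_pi_apply t).stronglyMeasurable) (Nat.lt_succ_self t)
  play_meas t :=
    measurableSet_greedyPlay_of_greedyCounts hS γ r (measurableSet_greedyCounts hS γ r t)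
  play_mem _ _ := greedyChoice_mem _ _ _ _ _ _
  play_max _ _ _ hB := by
    simp only [perturbed_greedyPlay]
    exact sum_countIndex_le_greedyChoice _ _ _ _ _ _ hB
  reward_meas _ _ := measurable_const
  reward_law _ a := by rw [Measure.map_const, hr, measure_univ, one_smul]
  reward_indep t := by
    rw [MeasurableSpace.comap_const]
    exact indep_bot_left _

theorem theorem2 (γ : ℝ) (hγ : 0 < γ) :
    (∃ C : ℝ, ∀ (N : ℕ) (I : SemiBandit N) (Ω : Type*) [mΩ : MeasurableSpace Ω]
      (μ : Measure Ω) [IsProbabilityMeasure μ] (𝓕 : Filtration ℕ mΩ)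
      (Θ : ℕ → Ω → Finset (Finset (Fin N))) (w : ℕ → Ω → ℝ) (A : ℕ → Ω → Finset (Fin N))
      (X : ℕ → Fin N → Ω → ℝ), IsCLSGRun I γ μ 𝓕 Θ w A X →
      ∀ T : ℕ, 2 ≤ T →
        regret I μ Θ A T ≤ C * (Real.log T * Real.sqrt (I.maxCard * N * T))) ∧
    (∃ c : ℝ, 0 < c ∧ ∃ T₀ : ℕ, ∀ m : ℕ, 1 ≤ m → ∀ T : ℕ, T₀ ≤ T →
      ∃ I : SemiBandit (2 * m), I.IsTop m ∧
        (∃ (Ω : Type) (mΩ : MeasurableSpace Ω) (μ : Measure Ω) (𝓕 : Filtration ℕ mΩ)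
          (w : ℕ → Ω → ℝ) (A : ℕ → Ω → Finset (Fin (2 * m))) (X : ℕ → Fin (2 * m) → Ω → ℝ),
          IsProbabilityMeasure μ ∧ IsCLSGRun I γ μ 𝓕 (fun _ _ => I.feasible) w A X) ∧
        ∀ (Ω : Type*) [mΩ : MeasurableSpace Ω] (μ : Measure Ω) [IsProbabilityMeasure μ]
          (𝓕 : Filtration ℕ mΩ) (w : ℕ → Ω → ℝ) (A : ℕ → Ω → Finset (Fin (2 * m)))
          (X : ℕ → Fin (2 * m) → Ω → ℝ),
          IsCLSGRun I γ μ 𝓕 (fun _ _ => I.feasible) w A X →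
          c * Real.sqrt (m * (2 * m : ℕ) * T * Real.log T) ≤
            regret I μ (fun _ _ => I.feasible) A T) := by
  refine ⟨⟨1 + regretFactor γ ^ 2 + 3 / 2 * γ + 16, ?_⟩, ?_⟩
  · intro N I Ω _ μ _ 𝓕 Θ w A X h T hT
    exact h.regret_le hγ hT
  · obtain ⟨T₁, hT₁⟩ := exists_sqrt_log_div_div_mem_Icc γ (c := 8) (by norm_num)
    have hprob := gaussianReal_real_Ioi_pos 0 one_ne_zero 1
    refine ⟨(gaussianReal 0 1).real (Set.Ioi 1) * Real.sqrt γ / 512, by positivity, max T₁ 28, ?_⟩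
    intro m _ T hT
    have hΔ := hT₁ T (le_of_max_le_left hT)
    refine ⟨twoLevelInstance m _ hΔ, rfl, ?_, ?_⟩
    · exact ⟨ℕ → ℝ, inferInstance, _, _, _, _, _, inferInstance, isCLSGRun_greedyPlay _
        ⟨_, goodArms_mem_feasible_twoLevelInstance m hΔ⟩ γ _ fun _ => rfl⟩
    · intro Ω _ μ _ 𝓕 w A X h
      exact h.regret_ge hγ rfl (le_of_max_le_right hT)
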